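/- Let $n\ge 1$, $\Theta>0$, and let $\gamma_1,\dots,\gamma_n>0$ with $\sum_{k=1}^n\gamma_k=1$. Let $\mu_1,\dots,\mu_n$ be Borel probability measures on $\mathbb{R}$ and $\mu=\mu_1\otimes\dots\otimes\mu_n$. For $N\ge 1$ let $\alpha=(\alpha_1,\dots,\alpha_n)$ range over the configurations with $\alpha_k\in\{1,\dots,\lfloor 2^{\gamma_k\Theta N}\rfloor\}$, $k\le n$ (so that there are about $2^{\Theta N}$ of them). For every $N$ let $X^{(k)}_{\alpha_1,\dots,\alpha_k,i}$ ($1\le k\le n$, $1\le i\le N$) be independent real random variables, $X^{(k)}_{\alpha_1,\dots,\alpha_k,i}$ having law $\mu_k$, all defined on one probability space; the joint law for different $N$ is arbitrary (in particular the same array may be used for all $N$). Put $$X_{\alpha,i}=\bigl(X^{(1)}_{\alpha_1,i},X^{(2)}_{\alpha_1,\alpha_2,i},\dots,X^{(n)}_{\alpha_1,\dots,\alpha_n,i}\bigr)\in\mathbb{R}^n,\qquad L_{N,\alpha}=\frac1N\sum_{i=1}^N\delta_{X_{\alpha,i}}.$$ Let $\mathbf{\Phi}$ be a continuous real-valued functional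 on the space $\mathcal{M}_1^+(\mathbb{R}^n)$ of Borel probability measures on $\mathbb{R}^n$ with the topology of weak convergence, and let $$f_N=\frac1N\log\sum_{\alpha}\exp\bigl(N\,\mathbf{\Phi}[L_{N,\alpha}]\bigr).$$ Write $H(\cdot\mid\cdot)$ for relative entropy and $\nu^{(k)}$ for the marginal of $\nu$ on the first $k$ coordinates. Then, almost surely, $f_N$ converges as $N\to\infty$ to the deterministic finite limit $$f=\sup_{\nu\in\mathcal{K}}\Bigl(\mathbf{\Phi}[\nu]-H(\nu\mid\mu)+\Theta\log 2\Bigr),$$ where $$\mathcal{K}=\Bigl\{\nu\in\mathcal{M}_1^+(\mathbb{R}^n):\ H(\nu^{(k)}\mid\mu^{(k)})\le\Theta\log 2\sum_{j=1}^k\gamma_j\ \text{ for all } k\in\{1,\dots,n\}\Bigr\}.$$ -/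

import Mathlib

open MeasureTheory ProbabilityTheory Filter Topology

noncomputable section

namespace GREM

variable {n : ℕ}

/-- The number of values of the `k`-th hierarchical index at volume `N`: the integer part of
`2 ^ (γ k * Θ * N)`. -/
def branching (Θ : ℝ) (γ : Fin n → ℝ) (N : ℕ) (k : Fin n) : ℕ :=
  ⌊(2 : ℝ) ^ (γ k * Θ * (N : ℝ))⌋₊

/-- The configurations `α = (α_1, …, α_n)` at volume `N`. -/
abbrev Config (Θ : ℝ) (γ : Fin n → ℝ) (N : ℕ) : Type :=
  (k : Fin n) → Fin (branching Θ γ N k)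

/-- The initial segments `(α_1, …, α_k)` of configurations (up to and including the index `k`). -/
abbrev Segment (Θ : ℝ) (γ : Fin n → ℝ) (N : ℕ) (k : Fin n) : Type :=
  (j : {j : Fin n // j ≤ k}) → Fin (branching Θ γ N j.1)

/-- The labels `(k, (α_1, …, α_k), i)` of the scalar random variables at volume `N`. -/
abbrev Site (Θ : ℝ) (γ : Fin n → ℝ) (N : ℕ) : Type :=
  Σ k : Fin n, Segment Θ γ N k × Fin N

/-- The initial segment of a configuration up to and including the index `k`. -/
def Config.segment {Θ : ℝ} {γ : Fin n → ℝ} {N : ℕ} (α : Config Θ γ N) (k : Fin n) :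
    Segment Θ γ N k :=
  fun j => α j.1

/-- The vector `X_{α,i} ∈ ℝ^n`, whose `k`-th coordinate is the variable labelled by
`(k, (α_1, …, α_k), i)`. -/
def spinVector {Θ : ℝ} {γ : Fin n → ℝ} {N : ℕ} (x : Site Θ γ N → ℝ) (α : Config Θ γ N)
    (i : Fin N) : Fin n → ℝ :=
  fun k => x ⟨k, Config.segment α k, i⟩

/-- The empirical measure `N⁻¹ ∑ δ_{x_i}` of `N ≥ 1` points. -/
def empirical {S : Type*} [MeasurableSpace S] {N : ℕ} [NeZero N] (x : Fin N → S) :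
    ProbabilityMeasure S :=
  ⟨(N : ENNReal)⁻¹ • ∑ i : Fin N, Measure.dirac (x i), ⟨by
    simp [Measure.smul_apply, ENNReal.inv_mul_cancel, NeZero.ne N]⟩⟩

/-- `f_N = N⁻¹ log ∑_α exp (N Φ[L_{N,α}])`, for given values `x` of the scalar variables. -/
def freeEnergy {Θ : ℝ} {γ : Fin n → ℝ} {N : ℕ} [NeZero N]
    (Φ : ProbabilityMeasure (Fin n → ℝ) → ℝ) (x : Site Θ γ N → ℝ) : ℝ :=
  1 / (N : ℝ) *
    Real.log (∑ α : Config Θ γ N, Real.exp ((N : ℝ) * Φ (empirical (spinVector x α))))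

/-- The marginal of a measure on `ℝ^n` on the coordinates up to and including `k`. -/
def marginal (k : Fin n) (ν : Measure (Fin n → ℝ)) : Measure ({j : Fin n // j ≤ k} → ℝ) :=
  ν.map (fun x j => x j.1)

/-- The set `𝒦` of probability measures `ν` with `H(ν^(k) | μ^(k)) ≤ Θ log 2 ∑_{j ≤ k} γ_j` for
all `k`, where `H` is the relative entropy. -/
def entropySet (Θ : ℝ) (γ : Fin n → ℝ) (μ : Measure (Fin n → ℝ)) :
    Set (ProbabilityMeasure (Fin n → ℝ)) :=
  {ν | ∀ k : Fin n,
    InformationTheory.klDiv (marginal k (ν : Measure (Fin n → ℝ))) (marginal k μ) ≤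
      ENNReal.ofReal (Θ * Real.log 2 * ∑ j ∈ Finset.Iic k, γ j)}

end GREM

end

/-! The limit comes from counting, for each `ν`, the configurations whose empirical measure is near
`ν`. For a single configuration the probability of this is about `exp (-N H(ν|μ))`, and there are
about `exp (N Θ log 2)` configurations, so the expected count has rate `Θ log 2 - H(ν|μ)`. Each such
configuration contributes `exp (N Φ ν)`. The hierarchy enters through the constraints: the first `k`
coordinates of the empirical measure depend only on the initial segment up to `k`, and there are too
few segments to produce a marginal of larger entropy.

Upper bound: the Donsker-Varadhan formula with bounded continuous test functions
(`exists_boundedContinuous_lt`) turns the exponential Chebyshev inequality into an estimate on a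
weak neighbourhood of `ν`. Markov's inequality bounds the count there
(`exists_isOpen_ae_eventually_hitCount_le`). If a constraint fails at level `k`, a union bound over
segments shows that eventually nothing falls near `ν` (`exists_nhds_ae_eventually_notMem`).
Exponential tightness leaves a compact set, covered by finitely many such neighbourhoods.

Lower bound: mixing `ν` with `μ` makes every constraint strict (`klDiv_mixture_le`). For a strict
`ν` with density `φ`, the law of large numbers under `ν` and a change of measure bound the
probability of a typical set from below (`eventually_typicalSet`). The second moment method then
applies (`siteMeasure_hitCount_lt_le`): two configurations agreeing exactly up to `k` are correlated
only through the marginal density at level `k`, and strictness makes the relative variance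
exponentially small.

All error probabilities are summable in `N`, so Borel-Cantelli applies whatever the coupling between
different `N`. -/

namespace GREM

open scoped ENNReal
open InformationTheory

/-! ### Donsker-Varadhan lower approximation of the relative entropy. -/

section

/-- The logarithm truncated at the levels `-M` and `M`. -/
noncomputable def truncLog (M x : ℝ) : ℝ := Real.log (max (Real.exp (-M)) (min (Real.exp M) x))

lemma exp_truncLog (M x : ℝ) :
    Real.exp (truncLog M x) = max (Real.exp (-M)) (min (Real.exp M) x) :=
  Real.exp_log (lt_max_of_lt_left (Real.exp_pos _))

lemma abs_truncLog_le {M : ℝ} (hM : 0 ≤ M) (x : ℝ) : |truncLog M x| ≤ M := by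
  have h := exp_truncLog M x
  rw [abs_le]
  constructor
  · rw [← Real.exp_le_exp, h]; exact le_max_left _ _
  · rw [← Real.exp_le_exp, h]
    exact max_le (Real.exp_le_exp.2 (by linarith)) (min_le_left _ _)

lemma measurable_truncLog (M : ℝ) : Measurable (truncLog M) := by
  unfold truncLog; fun_prop

/-- Nonnegativity is what Fatou's lemma needs below. Under the lower cut it is `exp (-M) * (M + 1) ≤
1`, between the cuts it is `klFun_nonneg`, and above the upper cut it uses `1 ≤ M`. -/
lemma truncLog_klFun_nonneg {M x : ℝ} (hM : 1 ≤ M) (hx : 0 ≤ x) :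
    0 ≤ x * truncLog M x + 1 - x := by
  by_cases h1 : x < Real.exp (-M)
  · have : truncLog M x = -M := by
      have h2 : x ≤ Real.exp M := h1.le.trans (Real.exp_le_exp.2 (by linarith))
      rw [truncLog, min_eq_right h2, max_eq_left h1.le, Real.log_exp]
    rw [this]
    have h3 : Real.exp (-M) * (M + 1) ≤ 1 := by
      rw [Real.exp_neg, inv_mul_le_iff₀ (Real.exp_pos _)]
      linarith [Real.add_one_le_exp M]
    nlinarith
  · push Not at h1
    by_cases h2 : x ≤ Real.exp M
    · rw [truncLog, min_eq_right h2, max_eq_right h1]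
      exact klFun_nonneg hx
    · push Not at h2
      have : truncLog M x = M := by
        rw [truncLog, min_eq_left h2.le, max_eq_right (Real.exp_le_exp.2 (by linarith)),
          Real.log_exp]
      rw [this]
      nlinarith

lemma tendsto_truncLog_klFun {x : ℝ} (hx : 0 ≤ x) :
    Tendsto (fun M : ℕ => x * truncLog M x + 1 - x) atTop (𝓝 (klFun x)) := by
  rcases hx.eq_or_lt with rfl | hx
  · simp [klFun_zero]
  have h1 : ∀ᶠ M : ℕ in atTop, |Real.log x| ≤ M :=
    (tendsto_natCast_atTop_atTop (R := ℝ)).eventually_ge_atTop _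
  refine tendsto_const_nhds.congr' ?_
  filter_upwards [h1] with M hM
  rw [abs_le] at hM
  have h2 : Real.exp (-M) ≤ x := by
    rw [← Real.exp_log hx]; exact Real.exp_le_exp.2 hM.1
  have h3 : x ≤ Real.exp M := by
    rw [← Real.exp_log hx]; exact Real.exp_le_exp.2 hM.2
  rw [truncLog, min_eq_right h3, max_eq_right h2, klFun]

section DonskerVaradhan

variable {E : Type*} [MeasurableSpace E] {ν m : Measure E} [IsProbabilityMeasure ν]
  [IsProbabilityMeasure m]

lemma integrable_of_abs_le {g : E → ℝ} (hg : Measurable g) {M : ℝ} (hM : ∀ x, |g x| ≤ M)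
    (ρ : Measure E) [IsFiniteMeasure ρ] : Integrable g ρ :=
  Integrable.of_bound hg.aestronglyMeasurable M (ae_of_all _ hM)

lemma integrable_exp_of_abs_le {g : E → ℝ} (hg : Measurable g) {M : ℝ} (hM : ∀ x, |g x| ≤ M)
    (ρ : Measure E) [IsFiniteMeasure ρ] : Integrable (fun x => Real.exp (g x)) ρ :=
  Integrable.of_bound (hg.exp).aestronglyMeasurable (Real.exp M) (ae_of_all _ fun x => by
    rw [Real.norm_eq_abs, Real.abs_exp]
    exact Real.exp_le_exp.2 ((le_abs_self _).trans (hM x)))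

lemma integral_exp_pos_of_abs_le {g : E → ℝ} (hg : Measurable g) {M : ℝ} (hM : ∀ x, |g x| ≤ M)
    (ρ : Measure E) [IsProbabilityMeasure ρ] : 0 < ∫ x, Real.exp (g x) ∂ρ :=
  integral_exp_pos (integrable_exp_of_abs_le hg hM ρ)

/-- Donsker-Varadhan: the variational lower bound by bounded measurable functions, for a measure
that is not absolutely continuous. -/
lemma exists_measurable_lt_of_not_ac (h : ¬ ν ≪ m) (a : ℝ) :
    ∃ (g : E → ℝ) (M : ℝ), Measurable g ∧ (∀ x, |g x| ≤ M) ∧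
      a < ∫ x, g x ∂ν - Real.log (∫ x, Real.exp (g x) ∂m) := by
  obtain ⟨s, hs, hms, hνs⟩ : ∃ s, MeasurableSet s ∧ m s = 0 ∧ ν s ≠ 0 := by
    by_contra! hcon
    exact h (Measure.AbsolutelyContinuous.mk fun s hs h0 => hcon s hs h0)
  have hpos : 0 < ν.real s := by
    rw [measureReal_def]; exact ENNReal.toReal_pos hνs (measure_ne_top _ _)
  obtain ⟨t, ht⟩ : ∃ t : ℝ, a < t * ν.real s :=
    ⟨(a + 1) / ν.real s, by rw [div_mul_cancel₀ _ hpos.ne']; linarith⟩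
  -- A large constant on an `m`-null set charged by `ν` raises the first integral and leaves the
  -- exponential moment equal to 1.
  refine ⟨s.indicator fun _ => t, |t|, measurable_const.indicator hs, fun x => ?_, ?_⟩
  · by_cases hx : x ∈ s <;> simp [hx]
  · have h1 : ∫ x, Real.exp (s.indicator (fun _ => t) x) ∂m = 1 := by
      have : (fun x => Real.exp (s.indicator (fun _ => t) x)) =ᵐ[m] fun _ => 1 := by
        have : ∀ᵐ x ∂m, x ∉ s := measure_eq_zero_iff_ae_notMem.1 hms
        filter_upwards [this] with x hx
        simp [hx]
      rw [integral_congr_ae this]; simp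
    rw [h1, Real.log_one, sub_zero, integral_indicator_const _ hs, smul_eq_mul, mul_comm]
    exact ht

/-- The test functions are truncated log-likelihood ratios, whose exponential moment under `m` is at
most `1 + exp (-M)`. If no test exceeded `a`, their `ν`-integrals would be at most `a + exp (-M)`.
These are also the `m`-integrals of the nonnegative truncations of `klFun`, so Fatou would give
`klDiv ν m ≤ ENNReal.ofReal a`. -/
lemma exists_measurable_lt_of_ac (h : ν ≪ m) {a : ℝ} (ha : ENNReal.ofReal a < klDiv ν m) :
    ∃ (g : E → ℝ) (M : ℝ), Measurable g ∧ (∀ x, |g x| ≤ M) ∧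
      a < ∫ x, g x ∂ν - Real.log (∫ x, Real.exp (g x) ∂m) := by
  by_contra! hcon
  refine ha.not_ge ?_
  set l : E → ℝ := fun x => (ν.rnDeriv m x).toReal with hl
  have hlm : Measurable l := (Measure.measurable_rnDeriv ν m).ennreal_toReal
  have hl0 : ∀ x, 0 ≤ l x := fun x => ENNReal.toReal_nonneg
  have hli : Integrable l m := Measure.integrable_toReal_rnDeriv
  have hl1 : ∫ x, l x ∂m = 1 := by
    rw [Measure.integral_toReal_rnDeriv h]; simp
  have hgm : ∀ M : ℕ, Measurable fun x => truncLog M (l x) :=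
    fun M => (measurable_truncLog M).comp hlm
  have hgb : ∀ (M : ℕ) x, |truncLog M (l x)| ≤ M :=
    fun M x => abs_truncLog_le (Nat.cast_nonneg M) _
  have hint : ∀ M : ℕ, Integrable (fun x => l x * truncLog M (l x)) m := fun M =>
    hli.mul_bdd (c := M) (hgm M).aestronglyMeasurable (ae_of_all _ (hgb M))
  have hint1 : ∀ M : ℕ, Integrable (fun x => l x * truncLog M (l x) + 1) m := fun M =>
    (hint M).add (integrable_const _)
  have hint2 : ∀ M : ℕ, Integrable (fun x => l x * truncLog M (l x) + 1 - l x) m := fun M =>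
    (hint1 M).sub hli
  have hval : ∀ M : ℕ, ∫ x, truncLog M (l x) ∂ν ≤ a + Real.exp (-M) := by
    intro M
    have h1 := hcon _ M (hgm M) (hgb M)
    have h2 : ∫ x, Real.exp (truncLog M (l x)) ∂m ≤ 1 + Real.exp (-M) := by
      calc ∫ x, Real.exp (truncLog M (l x)) ∂m ≤ ∫ x, (l x + Real.exp (-M)) ∂m := by
            refine integral_mono (integrable_exp_of_abs_le (hgm M) (hgb M) m)
              (hli.add (integrable_const _)) fun x => ?_
            rw [exp_truncLog]
            refine max_le (by linarith [hl0 x]) ((min_le_right _ _).trans ?_)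
            linarith [Real.exp_pos (-(M : ℝ))]
        _ = 1 + Real.exp (-M) := by
            rw [integral_add hli (integrable_const _), hl1]; simp
    have h3 := Real.log_le_sub_one_of_pos (integral_exp_pos_of_abs_le (hgm M) (hgb M) m)
    linarith
  have hu : ∀ M : ℕ, ∫ x, (l x * truncLog M (l x) + 1 - l x) ∂m = ∫ x, truncLog M (l x) ∂ν := by
    intro M
    have h4 := integral_rnDeriv_smul h (f := fun x => truncLog M (l x))
    simp only [smul_eq_mul] at h4
    have h5 : ∫ x, (l x * truncLog M (l x) + 1 - l x) ∂m
        = ∫ x, l x * truncLog M (l x) ∂m + 1 - ∫ x, l x ∂m := by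
      rw [integral_sub (hint1 M) hli,
        integral_add (hint M) (integrable_const _)]
      simp
    rw [h5, hl1, ← h4]; simp [hl]
  rw [klDiv_eq_lintegral_klFun_of_ac h]
  have hlim : ∀ x, ENNReal.ofReal (klFun (l x)) =
      liminf (fun M : ℕ => ENNReal.ofReal (l x * truncLog M (l x) + 1 - l x)) atTop := fun x =>
    (((ENNReal.continuous_ofReal.tendsto _).comp (tendsto_truncLog_klFun (hl0 x))).liminf_eq).symm
  calc ∫⁻ x, ENNReal.ofReal (klFun (l x)) ∂m
      = ∫⁻ x, liminf (fun M : ℕ => ENNReal.ofReal (l x * truncLog M (l x) + 1 - l x)) atTop ∂m :=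
        lintegral_congr hlim
    _ ≤ liminf (fun M : ℕ => ∫⁻ x, ENNReal.ofReal (l x * truncLog M (l x) + 1 - l x) ∂m) atTop :=
        lintegral_liminf_le fun M =>
          (((hlm.mul (hgm M)).add measurable_const).sub hlm).ennreal_ofReal
    _ ≤ liminf (fun M : ℕ => ENNReal.ofReal (a + Real.exp (-M))) atTop := by
        refine liminf_le_liminf ?_
        filter_upwards [eventually_ge_atTop 1] with M hM
        rw [← ofReal_integral_eq_lintegral_ofReal (hint2 M)
          (ae_of_all _ fun x => truncLog_klFun_nonneg (by exact_mod_cast hM) (hl0 x)), hu]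
        exact ENNReal.ofReal_le_ofReal (hval M)
    _ = ENNReal.ofReal a := by
        refine Tendsto.liminf_eq ((ENNReal.continuous_ofReal.tendsto a).comp ?_)
        have : Tendsto (fun M : ℕ => Real.exp (-(M : ℝ))) atTop (𝓝 0) :=
          Real.tendsto_exp_neg_atTop_nhds_zero.comp tendsto_natCast_atTop_atTop
        simpa using this.const_add a

lemma exists_measurable_lt {a : ℝ} (ha : ENNReal.ofReal a < klDiv ν m) :
    ∃ (g : E → ℝ) (M : ℝ), Measurable g ∧ (∀ x, |g x| ≤ M) ∧
      a < ∫ x, g x ∂ν - Real.log (∫ x, Real.exp (g x) ∂m) := by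
  by_cases h : ν ≪ m
  · exact exists_measurable_lt_of_ac h ha
  · exact exists_measurable_lt_of_not_ac h a

lemma abs_exp_sub_exp_le {M x y : ℝ} (hx : |x| ≤ M) (hy : |y| ≤ M) :
    |Real.exp x - Real.exp y| ≤ Real.exp M * |x - y| := by
  wlog hxy : y ≤ x generalizing x y
  · rw [abs_sub_comm, abs_sub_comm x y]; exact this hy hx (le_of_not_ge hxy)
  rw [abs_of_nonneg (sub_nonneg.2 (Real.exp_le_exp.2 hxy)), abs_of_nonneg (sub_nonneg.2 hxy)]
  have h1 : Real.exp y = Real.exp x * Real.exp (y - x) := by rw [← Real.exp_add]; ring_nf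
  have h2 := Real.add_one_le_exp (y - x)
  have h3 : Real.exp x ≤ Real.exp M := Real.exp_le_exp.2 ((le_abs_self _).trans hx)
  rw [h1]
  nlinarith [Real.exp_pos x, Real.exp_pos M]

variable [TopologicalSpace E] [NormalSpace E] [BorelSpace E]

/-- Approximating in `L¹(ν + m)` serves both measures with one function. Clamping to `[-M, M]` is
1-Lipschitz, hence costs nothing, and keeps the uniform bound under which `exp` is Lipschitz. -/
lemma exists_boundedContinuous_near {g : E → ℝ} (hg : Measurable g) {M : ℝ}
    (hM : ∀ x, |g x| ≤ M) {ε : ℝ} (hε : 0 < ε) [(ν + m).WeaklyRegular] :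
    ∃ f : BoundedContinuousFunction E ℝ, (∀ x, |f x| ≤ M) ∧
      ∫ x, |g x - f x| ∂ν ≤ ε ∧ ∫ x, |g x - f x| ∂m ≤ ε := by
  obtain ⟨f₀, hf₀, hf₀i⟩ :=
    (integrable_of_abs_le hg hM (ν + m)).exists_boundedContinuous_integral_sub_le hε
  have hE : Nonempty E := ⟨(nonempty_of_isProbabilityMeasure m).some⟩
  have hM0 : 0 ≤ M := (abs_nonneg _).trans (hM hE.some)
  have hfb : ∀ x, |max (-M) (min M (f₀ x))| ≤ M := fun x =>
    abs_le.2 ⟨le_max_left _ _, max_le (by linarith) (min_le_left _ _)⟩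
  let f : BoundedContinuousFunction E ℝ := BoundedContinuousFunction.ofNormedAddCommGroup
    (fun x => max (-M) (min M (f₀ x))) (by fun_prop) M hfb
  have hle : ∀ x, |g x - f x| ≤ ‖g x - f₀ x‖ := by
    intro x
    have hgx := abs_le.1 (hM x)
    have h1 : g x = max (-M) (min M (g x)) := by rw [min_eq_right hgx.2, max_eq_right hgx.1]
    calc |g x - f x| = |max (min M (g x)) (-M) - max (min M (f₀ x)) (-M)| := by
          conv_lhs => rw [h1]
          simp only [f, BoundedContinuousFunction.coe_ofNormedAddCommGroup]
          rw [max_comm (-M), max_comm (-M)]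
      _ ≤ |min M (g x) - min M (f₀ x)| := abs_max_sub_max_le_abs _ _ _
      _ ≤ |g x - f₀ x| := by
          rw [min_comm M, min_comm M]
          have := abs_min_sub_min_le_max (g x) M (f₀ x) M
          simpa using this
  have hi : Integrable (fun x => |g x - f x|) (ν + m) :=
    ((integrable_of_abs_le hg hM _).sub (f.integrable _)).abs
  have hi₀ : Integrable (fun x => ‖g x - f₀ x‖) (ν + m) :=
    ((integrable_of_abs_le hg hM _).sub hf₀i).norm
  have htot : ∫ x, |g x - f x| ∂(ν + m) ≤ ε := (integral_mono hi hi₀ hle).trans hf₀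
  rw [integral_add_measure hi.left_of_add_measure hi.right_of_add_measure] at htot
  have h1 : 0 ≤ ∫ x, |g x - f x| ∂ν := integral_nonneg fun x => abs_nonneg _
  have h2 : 0 ≤ ∫ x, |g x - f x| ∂m := integral_nonneg fun x => abs_nonneg _
  exact ⟨f, hfb, by linarith, by linarith⟩

/-- Donsker-Varadhan: the relative entropy is approached from below by bounded continuous
functions. -/
lemma exists_boundedContinuous_lt [(ν + m).WeaklyRegular] {a : ℝ}
    (ha : ENNReal.ofReal a < klDiv ν m) :
    ∃ g : BoundedContinuousFunction E ℝ,
      a < ∫ x, g x ∂ν - Real.log (∫ x, Real.exp (g x) ∂m) := by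
  obtain ⟨g, M, hg, hM, hlt⟩ := exists_measurable_lt ha
  have hex : ∀ j : ℕ, ∃ f : BoundedContinuousFunction E ℝ, (∀ x, |f x| ≤ M) ∧
      ∫ x, |g x - f x| ∂ν ≤ 1 / ((j : ℝ) + 1) ∧ ∫ x, |g x - f x| ∂m ≤ 1 / ((j : ℝ) + 1) :=
    fun j => exists_boundedContinuous_near hg hM (by positivity)
  choose f hfM hfν hfm using hex
  have h0 := tendsto_one_div_add_atTop_nhds_zero_nat (𝕜 := ℝ)
  have h1 : Tendsto (fun j => ∫ x, f j x ∂ν) atTop (𝓝 (∫ x, g x ∂ν)) := by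
    rw [tendsto_iff_norm_sub_tendsto_zero]
    refine squeeze_zero (fun _ => norm_nonneg _) (fun j => ?_) h0
    rw [← integral_sub ((f j).integrable _) (integrable_of_abs_le hg hM _)]
    refine (norm_integral_le_integral_norm _).trans (le_trans (le_of_eq ?_) (hfν j))
    exact integral_congr_ae (ae_of_all _ fun x => by
      simp only [Real.norm_eq_abs]; rw [abs_sub_comm])
  have h2 : Tendsto (fun j => ∫ x, Real.exp (f j x) ∂m) atTop (𝓝 (∫ x, Real.exp (g x) ∂m)) := by
    rw [tendsto_iff_norm_sub_tendsto_zero]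
    have h3 := h0.const_mul (Real.exp M)
    rw [mul_zero] at h3
    refine squeeze_zero (fun _ => norm_nonneg _) (fun j => ?_) h3
    have hfm' : Measurable (f j) := (f j).continuous.measurable
    rw [← integral_sub (integrable_exp_of_abs_le hfm' (hfM j) _)
      (integrable_exp_of_abs_le hg hM _)]
    refine (norm_integral_le_integral_norm _).trans ?_
    calc ∫ x, ‖Real.exp (f j x) - Real.exp (g x)‖ ∂m
        ≤ ∫ x, Real.exp M * |g x - f j x| ∂m := by
          refine integral_mono ((integrable_exp_of_abs_le hfm' (hfM j) _).sub
            (integrable_exp_of_abs_le hg hM _)).norm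
            ((((integrable_of_abs_le hg hM _).sub ((f j).integrable _)).abs).const_mul _)
            fun x => ?_
          simp only [Real.norm_eq_abs]
          rw [abs_sub_comm (g x)]
          exact abs_exp_sub_exp_le (hfM j x) (hM x)
      _ = Real.exp M * ∫ x, |g x - f j x| ∂m := integral_const_mul _ _
      _ ≤ Real.exp M * (1 / ((j : ℝ) + 1)) := by
          gcongr
          exact hfm j
  have h4 := h1.sub ((Real.continuousAt_log (integral_exp_pos_of_abs_le hg hM m).ne').tendsto.comp h2)
  obtain ⟨j, hj⟩ := (h4.eventually_const_lt hlt).exists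
  exact ⟨f j, hj⟩

end DonskerVaradhan

end

/-! ### Product measures, Chernoff bound and exponential tightness for empirical measures. -/

section

section Product

variable {ι : Type*} [Fintype ι] {E : Type*} [MeasurableSpace E] {m : Measure E}
  [IsProbabilityMeasure m]

lemma lintegral_pi_prod {f : ι → E → ℝ≥0∞} (hf : ∀ i, Measurable (f i)) :
    ∫⁻ y, ∏ i, f i (y i) ∂(Measure.pi fun _ : ι => m) = ∏ i, ∫⁻ x, f i x ∂m := by
  have h := lintegral_prod_eq_prod_lintegral_of_indepFun Finset.univ
    (fun i (y : ι → E) => f i (y i))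
    (iIndepFun_pi (μ := fun _ : ι => m) fun i => (hf i).aemeasurable)
    (fun i => (hf i).comp (measurable_pi_apply i))
  rw [h]
  refine Finset.prod_congr rfl fun i _ => ?_
  exact (measurePreserving_eval (fun _ : ι => m) i).lintegral_comp (hf i)

lemma pi_withDensity {φ : E → ℝ≥0∞} (hφ : Measurable φ)
    [IsProbabilityMeasure (m.withDensity φ)] :
    (Measure.pi fun _ : ι => m.withDensity φ) =
      (Measure.pi fun _ : ι => m).withDensity fun y => ∏ i, φ (y i) := by
  refine Measure.pi_eq fun s hs => ?_
  rw [withDensity_apply _ (MeasurableSet.univ_pi hs),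
    ← lintegral_indicator (MeasurableSet.univ_pi hs)]
  calc ∫⁻ y, (Set.univ.pi s).indicator (fun y => ∏ i, φ (y i)) y ∂(Measure.pi fun _ : ι => m)
      = ∫⁻ y, ∏ i, (s i).indicator φ (y i) ∂(Measure.pi fun _ : ι => m) := by
        refine lintegral_congr fun y => ?_
        by_cases hy : y ∈ Set.univ.pi s
        · rw [Set.indicator_of_mem hy]
          exact Finset.prod_congr rfl fun i _ =>
            (Set.indicator_of_mem (hy i (Set.mem_univ i)) φ).symm
        · rw [Set.indicator_of_notMem hy]
          simp only [Set.mem_pi, Set.mem_univ, true_imp_iff, not_forall] at hy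
          obtain ⟨i, hi⟩ := hy
          exact (Finset.prod_eq_zero (Finset.mem_univ i) (Set.indicator_of_notMem hi φ)).symm
    _ = ∏ i, (m.withDensity φ) (s i) := by
        rw [lintegral_pi_prod fun i => hφ.indicator (hs i)]
        refine Finset.prod_congr rfl fun i _ => ?_
        rw [lintegral_indicator (hs i), withDensity_apply _ (hs i)]

end Product

section Empirical

variable {E : Type*} [MeasurableSpace E] {N : ℕ} [NeZero N]

lemma coe_empirical (x : Fin N → E) :
    (empirical x : Measure E) = (N : ℝ≥0∞)⁻¹ • ∑ i : Fin N, Measure.dirac (x i) := rfl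

lemma integral_empirical (x : Fin N → E) {g : E → ℝ} (hg : Measurable g) :
    ∫ y, g y ∂(empirical x : Measure E) = (N : ℝ)⁻¹ * ∑ i, g (x i) := by
  have hi : ∀ i ∈ Finset.univ, Integrable g (Measure.dirac (x i)) := fun i _ => by
    refine (integrable_dirac' hg.stronglyMeasurable) ?_
    simp
  rw [coe_empirical, integral_smul_measure, integral_finsetSum_measure hi]
  simp [integral_dirac' _ _ hg.stronglyMeasurable]

lemma continuous_empirical [TopologicalSpace E] [OpensMeasurableSpace E] :
    Continuous fun x : Fin N → E => empirical x := by
  rw [continuous_iff_continuousAt]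
  intro x
  rw [ContinuousAt, ProbabilityMeasure.tendsto_iff_forall_integral_tendsto]
  intro f
  simp only [integral_empirical _ f.continuous.measurable]
  have : Continuous fun x : Fin N → E => (N : ℝ)⁻¹ * ∑ i, f (x i) := by fun_prop
  exact this.tendsto x

variable {m : Measure E} [IsProbabilityMeasure m]

/-- The exponential Chebyshev inequality for empirical measures. -/
lemma chernoff_empirical {g : E → ℝ} (hg : Measurable g) {M : ℝ} (hM : ∀ x, |g x| ≤ M) (a : ℝ) :
    (Measure.pi fun _ : Fin N => m) {y | a < ∫ x, g x ∂(empirical y : Measure E) -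
        Real.log (∫ x, Real.exp (g x) ∂m)} ≤ ENNReal.ofReal (Real.exp (-(a * N))) := by
  set Z := ∫ x, Real.exp (g x) ∂m with hZ
  have hZpos : 0 < Z := integral_exp_pos_of_abs_le hg hM m
  have hN : (0 : ℝ) < N := by exact_mod_cast NeZero.pos N
  set F : (Fin N → E) → ℝ≥0∞ := fun y => ∏ i, ENNReal.ofReal (Real.exp (g (y i))) with hF
  have hint : ∫⁻ y, F y ∂(Measure.pi fun _ : Fin N => m) = ENNReal.ofReal (Z ^ N) := by
    rw [hF, lintegral_pi_prod (f := fun _ x => ENNReal.ofReal (Real.exp (g x)))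
      (fun _ => hg.exp.ennreal_ofReal), Finset.prod_const, Finset.card_univ, Fintype.card_fin,
      ← ofReal_integral_eq_lintegral_ofReal (integrable_exp_of_abs_le hg hM m)
        (ae_of_all _ fun x => (Real.exp_pos _).le), ENNReal.ofReal_pow hZpos.le]
  have hFm : Measurable F := Finset.measurable_prod _ fun i _ =>
    (hg.comp (measurable_pi_apply i)).exp.ennreal_ofReal
  -- The product of the `exp (g (y i))` has mean `Z ^ N`, so Markov's inequality at this threshold
  -- leaves `exp (-a N)`.
  set c : ℝ := Real.exp (a * N) * Z ^ N with hc
  have hcpos : 0 < c := by positivity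
  calc _ ≤ (Measure.pi fun _ : Fin N => m) {y | ENNReal.ofReal c ≤ F y} := by
        refine measure_mono fun y hy => ?_
        simp only [Set.mem_ofPred_eq, integral_empirical y hg] at hy ⊢
        change _ ≤ ∏ i, ENNReal.ofReal (Real.exp (g (y i)))
        rw [← ENNReal.ofReal_prod_of_nonneg fun i _ => (Real.exp_pos _).le, ← Real.exp_sum]
        refine ENNReal.ofReal_le_ofReal ?_
        have h1 : c = Real.exp (a * N + N * Real.log Z) := by
          rw [Real.exp_add, hc, mul_comm (N : ℝ) (Real.log Z), Real.exp_mul (Real.log Z),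
            Real.exp_log hZpos, Real.rpow_natCast]
        rw [h1, Real.exp_le_exp]
        have h2 : ∑ i, g (y i) = N * ((N : ℝ)⁻¹ * ∑ i, g (y i)) := by field_simp
        rw [h2]
        nlinarith
    _ ≤ (∫⁻ y, F y ∂(Measure.pi fun _ : Fin N => m)) / ENNReal.ofReal c :=
        meas_ge_le_lintegral_div hFm.aemeasurable (by simpa using hcpos) ENNReal.ofReal_ne_top
    _ = ENNReal.ofReal (Real.exp (-(a * N))) := by
        rw [hint, ← ENNReal.ofReal_div_of_pos hcpos, hc, Real.exp_neg]
        congr 1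
        field_simp

/-- Exponential tightness of the empirical measures of independent variables. -/
lemma exists_isCompact_empirical [TopologicalSpace E] [PolishSpace E] [BorelSpace E] (b : ℝ) :
    ∃ K : Set (ProbabilityMeasure E), IsCompact K ∧ ∀ (N : ℕ) [NeZero N],
      (Measure.pi fun _ : Fin N => m) {y | empirical y ∉ K} ≤
        ENNReal.ofReal (Real.exp (-(b * N))) := by
  let _ := TopologicalSpace.upgradeIsCompletelyMetrizable E
  -- With mass threshold `1 / (j + 1)`, the height `t j` yields `|b| + j + 1 + log 2`. The `log 2`
  -- pays for an exponential moment of at most 2, the `|b|` for the required rate, and `j + 1` for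
  -- summation over `j`.
  set t : ℕ → ℝ := fun j => ((j : ℝ) + 1) * (|b| + j + 1 + Real.log 2) with ht
  have hC : ∀ j, ∃ C : Set E, IsCompact C ∧ m Cᶜ ≤ ENNReal.ofReal (Real.exp (-t j)) := by
    intro j
    have h := isTightMeasureSet_iff_exists_isCompact_measure_compl_le.1
      (isTightMeasureSet_singleton (μ := m)) (ENNReal.ofReal (Real.exp (-t j)))
      (by simpa using Real.exp_pos _)
    obtain ⟨C, hC, h⟩ := h
    exact ⟨C, hC, h m rfl⟩
  choose C hCc hCm using hC
  set u : ℕ → NNReal := fun j => ⟨1 / ((j : ℝ) + 1), by positivity⟩ with hu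
  have hu0 : Tendsto u atTop (𝓝 0) := by
    rw [← NNReal.tendsto_coe]
    exact tendsto_one_div_add_atTop_nhds_zero_nat
  -- By Prokhorov, the measures giving `(C j)ᶜ` mass at most `u j` for every `j` form a compact set.
  refine ⟨_, isCompact_setOfPred_probabilityMeasure_mass_eq_compl_isCompact_le hu0 hCc
    (Or.inl inferInstance), ?_⟩
  intro N _
  have hN : (1 : ℝ) ≤ N := by exact_mod_cast NeZero.one_le
  have hmeas : ∀ j, MeasurableSet (C j)ᶜ := fun j => (hCc j).measurableSet.compl
  have hstep : ∀ j, (Measure.pi fun _ : Fin N => m) {y | ¬ empirical y (C j)ᶜ ≤ u j} ≤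
      ENNReal.ofReal (Real.exp (-(b * N))) * 2⁻¹ ^ (j + 1) := by
    intro j
    set g : E → ℝ := (C j)ᶜ.indicator fun _ => t j with hg
    have hgm : Measurable g := measurable_const.indicator (hmeas j)
    have hlog2 := Real.log_pos one_lt_two
    have htj : 0 ≤ t j := by rw [ht]; positivity
    have hgb : ∀ x, |g x| ≤ t j := fun x => by
      by_cases hx : x ∈ (C j)ᶜ
      · rw [hg, Set.indicator_of_mem hx, abs_of_nonneg htj]
      · rw [hg, Set.indicator_of_notMem hx, abs_zero]; exact htj
    have hZ : ∫ x, Real.exp (g x) ∂m ≤ 2 := by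
      calc ∫ x, Real.exp (g x) ∂m
          ≤ ∫ x, (1 + (C j)ᶜ.indicator (fun _ => Real.exp (t j)) x) ∂m := by
            refine integral_mono (integrable_exp_of_abs_le hgm hgb m) ((integrable_const _).add
              ((integrable_const _).indicator (hmeas j))) fun x => ?_
            by_cases hx : x ∈ (C j)ᶜ
            · simp only [hg, Set.indicator_of_mem hx]; linarith
            · simp only [hg, Set.indicator_of_notMem hx, Real.exp_zero]; linarith
        _ = 1 + m.real (C j)ᶜ * Real.exp (t j) := by
            rw [integral_add (integrable_const _) ((integrable_const _).indicator (hmeas j)),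
              integral_indicator_const _ (hmeas j)]
            simp
        _ ≤ 1 + Real.exp (-t j) * Real.exp (t j) := by
            gcongr
            exact ENNReal.toReal_le_of_le_ofReal (Real.exp_pos _).le (hCm j)
        _ = 2 := by rw [← Real.exp_add]; norm_num
    have hlogZ : Real.log (∫ x, Real.exp (g x) ∂m) ≤ Real.log 2 :=
      Real.log_le_log (integral_exp_pos_of_abs_le hgm hgb m) hZ
    refine (measure_mono (fun y hy => ?_)).trans
      ((chernoff_empirical (m := m) hgm hgb (|b| + j + 1)).trans ?_)
    · simp only [Set.mem_ofPred_eq, not_le] at hy ⊢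
      have h1 : ∫ x, g x ∂(empirical y : Measure E) =
          t j * ((empirical y : Measure E) (C j)ᶜ).toReal := by
        rw [hg, integral_indicator_const _ (hmeas j), smul_eq_mul, mul_comm]; rfl
      have h2 : 1 / ((j : ℝ) + 1) < ((empirical y : Measure E) (C j)ᶜ).toReal :=
        NNReal.coe_lt_coe.2 hy
      rw [h1]
      have h3 : t j * (1 / ((j : ℝ) + 1)) = |b| + j + 1 + Real.log 2 := by
        rw [ht]; field_simp
      have h4 : t j * (1 / ((j : ℝ) + 1)) < t j * ((empirical y : Measure E) (C j)ᶜ).toReal :=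
        mul_lt_mul_of_pos_left h2 (by rw [ht]; positivity)
      linarith
    · have h5 : (2⁻¹ : ℝ≥0∞) ^ (j + 1) = ENNReal.ofReal ((2 : ℝ)⁻¹ ^ (j + 1)) := by
        rw [ENNReal.ofReal_pow (by norm_num), ENNReal.ofReal_inv_of_pos (by norm_num)]
        norm_num
      rw [h5, ← ENNReal.ofReal_mul (Real.exp_pos _).le]
      refine ENNReal.ofReal_le_ofReal ?_
      have h6 : Real.exp (-((j : ℝ) + 1)) ≤ (2 : ℝ)⁻¹ ^ (j + 1) := by
        have : Real.exp (-((j : ℝ) + 1)) = (Real.exp (-1)) ^ (j + 1) := by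
          rw [← Real.exp_nat_mul]; push_cast; ring_nf
        rw [this]
        refine pow_le_pow_left₀ (Real.exp_pos _).le ?_ _
        rw [Real.exp_neg]
        exact inv_anti₀ (by norm_num) (by linarith [Real.add_one_le_exp (1 : ℝ)])
      calc Real.exp (-((|b| + j + 1) * N))
          ≤ Real.exp (-(b * N)) * Real.exp (-((j : ℝ) + 1)) := by
            rw [← Real.exp_add, Real.exp_le_exp]
            have h7 := le_abs_self b
            have h8 : (0 : ℝ) ≤ j := Nat.cast_nonneg j
            nlinarith
        _ ≤ _ := by gcongr
  calc _ ≤ (Measure.pi fun _ : Fin N => m) (⋃ j, {y | ¬ empirical y (C j)ᶜ ≤ u j}) := by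
        refine measure_mono fun y hy => ?_
        simp only [Set.mem_ofPred_eq, not_forall] at hy
        simpa using hy
    _ ≤ ∑' j, (Measure.pi fun _ : Fin N => m) {y | ¬ empirical y (C j)ᶜ ≤ u j} :=
        measure_iUnion_le _
    _ ≤ ∑' j, ENNReal.ofReal (Real.exp (-(b * N))) * 2⁻¹ ^ (j + 1) := ENNReal.tsum_le_tsum hstep
    _ = _ := by rw [ENNReal.tsum_mul_left, ENNReal.tsum_geometric_add_one]; simp [ENNReal.inv_mul_cancel]

end Empirical

end

/-! ### Law of the spin vectors and dependence between two configurations. -/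

section

variable {n : ℕ} {Θ : ℝ} {γ : Fin n → ℝ} {N : ℕ}

lemma segment_eq_iff (α α' : Config Θ γ N) (k : Fin n) :
    α.segment k = α'.segment k ↔ ∀ j ≤ k, α j = α' j := by
  rw [funext_iff]
  exact ⟨fun h j hj => h ⟨j, hj⟩, fun h j => h j.1 j.2⟩

lemma measurable_spinVector (α : Config Θ γ N) :
    Measurable fun x : Site Θ γ N → ℝ => spinVector x α := by
  refine measurable_pi_lambda _ fun i => measurable_pi_lambda _ fun k => ?_
  exact measurable_pi_apply _

section Law

variable (Θ γ N)

/-- The joint law of the scalar variables at volume `N`. -/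
noncomputable def siteMeasure (μ : Fin n → Measure ℝ) : Measure (Site Θ γ N → ℝ) :=
  Measure.pi fun s : Site Θ γ N => μ s.1

variable {Θ γ N}

variable (μ : Fin n → Measure ℝ) [∀ k, IsProbabilityMeasure (μ k)]

instance : IsProbabilityMeasure (siteMeasure Θ γ N μ) := by
  unfold siteMeasure; infer_instance

lemma iIndepFun_site : iIndepFun (fun (s : Site Θ γ N) (x : Site Θ γ N → ℝ) => x s)
    (siteMeasure Θ γ N μ) :=
  iIndepFun_pi (μ := fun s : Site Θ γ N => μ s.1) (X := fun _ x => x) fun _ => aemeasurable_id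

/-- Within a single configuration the pairs `(i, k)` read distinct sites, so the hierarchy is
invisible and the `N` vectors are independent with law `Measure.pi μ`. -/
lemma map_spinVector (α : Config Θ γ N) :
    (siteMeasure Θ γ N μ).map (fun x => spinVector x α) =
      Measure.pi fun _ : Fin N => Measure.pi μ := by
  set e : Fin N × Fin n → Site Θ γ N := fun p => ⟨p.2, α.segment p.2, p.1⟩ with he
  have hinj : Function.Injective e := by
    rintro ⟨i, k⟩ ⟨i', k'⟩ h
    simp only [he, Sigma.mk.injEq] at h
    obtain ⟨rfl, h⟩ := h
    simpa using h
  have h1 := (iIndepFun_iff_map_fun_eq_pi_map fun p =>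
    (measurable_pi_apply (e p)).aemeasurable).1 ((iIndepFun_site μ).precomp hinj)
  have h2 : ∀ p, (siteMeasure Θ γ N μ).map (fun x => x (e p)) = μ p.2 := fun p =>
    (measurePreserving_eval (fun s : Site Θ γ N => μ s.1) (e p)).map_eq
  simp only [h2] at h1
  have h3 := Measure.infinitePi_map_curry (fun (_ : Fin N) k => μ k)
  simp only [Measure.infinitePi_eq_pi] at h3
  have hem : Measurable fun (x : Site Θ γ N → ℝ) (p : Fin N × Fin n) => x (e p) :=
    measurable_pi_lambda _ fun p => measurable_pi_apply _
  rw [← h3, ← h1, Measure.map_map (MeasurableEquiv.measurable _) hem]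
  rfl

lemma siteMeasure_preimage_spinVector (α : Config Θ γ N) {A : Set (Fin N → Fin n → ℝ)}
    (hA : MeasurableSet A) :
    siteMeasure Θ γ N μ {x | spinVector x α ∈ A} =
      (Measure.pi fun _ : Fin N => Measure.pi μ) A := by
  rw [← map_spinVector μ α, Measure.map_apply (measurable_spinVector α) hA]
  rfl

lemma siteMeasure_preimage_spinVector_le (α : Config Θ γ N) (A : Set (Fin N → Fin n → ℝ)) :
    siteMeasure Θ γ N μ {x | spinVector x α ∈ A} ≤
      (Measure.pi fun _ : Fin N => Measure.pi μ) A := by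
  rw [← map_spinVector μ α]
  exact Measure.le_map_apply (measurable_spinVector α).aemeasurable A

/-- Two configurations share a site at level `j` only if their segments up to `j` coincide, so here
the two families read disjoint sets of sites. -/
lemma indepFun_spinVector (α α' : Config Θ γ N) (J : Set (Fin n))
    (h : ∀ j ∈ J, α.segment j ≠ α'.segment j) :
    IndepFun (fun x => spinVector x α) (fun x (i : Fin N) (j : J) => spinVector x α' i j)
      (siteMeasure Θ γ N μ) := by
  classical
  set S : Finset (Site Θ γ N) :=
    Finset.univ.image fun p : Fin N × Fin n => ⟨p.2, α.segment p.2, p.1⟩ with hS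
  set T : Finset (Site Θ γ N) :=
    Finset.univ.image fun p : Fin N × J => ⟨p.2.1, α'.segment p.2.1, p.1⟩ with hT
  have hd : Disjoint S T := by
    rw [Finset.disjoint_left]
    intro s hs ht
    simp only [hS, hT, Finset.mem_image, Finset.mem_univ, true_and] at hs ht
    obtain ⟨⟨i, k⟩, rfl⟩ := hs
    obtain ⟨⟨i', k', hk'⟩, hp⟩ := ht
    simp only [Sigma.mk.injEq] at hp
    obtain ⟨rfl, hp⟩ := hp
    simp only [heq_eq_eq, Prod.mk.injEq] at hp
    exact h _ hk' hp.1.symm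
  have hSmem : ∀ i k, (⟨k, α.segment k, i⟩ : Site Θ γ N) ∈ S := fun i k =>
    Finset.mem_image.2 ⟨(i, k), Finset.mem_univ _, rfl⟩
  have hTmem : ∀ i (k : J), (⟨k.1, α'.segment k.1, i⟩ : Site Θ γ N) ∈ T := fun i k =>
    Finset.mem_image.2 ⟨(i, k), Finset.mem_univ _, rfl⟩
  have h1 := (iIndepFun_site (Θ := Θ) (γ := γ) (N := N) μ).indepFun_finset S T hd
    (fun s => measurable_pi_apply s)
  exact h1.comp
    (φ := fun (y : S → ℝ) (i : Fin N) (k : Fin n) => y ⟨_, hSmem i k⟩)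
    (ψ := fun (y : T → ℝ) (i : Fin N) (k : J) => y ⟨_, hTmem i k⟩)
    (measurable_pi_lambda _ fun i => measurable_pi_lambda _ fun k => measurable_pi_apply _)
    (measurable_pi_lambda _ fun i => measurable_pi_lambda _ fun k => measurable_pi_apply _)

lemma siteMeasure_inter_of_segment_ne {α α' : Config Θ γ N}
    (h : ∀ j, α.segment j ≠ α'.segment j) {A : Set (Fin N → Fin n → ℝ)} (hA : MeasurableSet A) :
    siteMeasure Θ γ N μ ({x | spinVector x α ∈ A} ∩ {x | spinVector x α' ∈ A}) =
      (Measure.pi fun _ : Fin N => Measure.pi μ) A *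
        (Measure.pi fun _ : Fin N => Measure.pi μ) A := by
  have h1 := (indepFun_spinVector μ α α' Set.univ fun j _ => h j).comp
    (φ := id) (ψ := fun (y : Fin N → ↥(Set.univ : Set (Fin n)) → ℝ) i k => y i ⟨k, trivial⟩)
    measurable_id
    (measurable_pi_lambda _ fun i => measurable_pi_lambda _ fun k =>
      (measurable_pi_apply _).comp (measurable_pi_apply i))
  rw [← siteMeasure_preimage_spinVector μ α hA]
  nth_rw 2 [siteMeasure_preimage_spinVector μ α hA]
  rw [← siteMeasure_preimage_spinVector μ α' hA]
  exact h1.measure_inter_preimage_eq_mul _ _ hA hA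

end Law

/-- The vector with the coordinates of `y` up to `k` and those of `z` beyond. -/
def splice (k : Fin n) (y z : Fin n → ℝ) : Fin n → ℝ := fun j => if j ≤ k then y j else z j

lemma measurable_splice (k : Fin n) :
    Measurable fun p : (Fin n → ℝ) × (Fin n → ℝ) => splice k p.1 p.2 := by
  refine measurable_pi_lambda _ fun j => ?_
  by_cases hj : j ≤ k
  · simp only [splice, if_pos hj]; fun_prop
  · simp only [splice, if_neg hj]; fun_prop

section Pair

variable (μ : Fin n → Measure ℝ) [∀ k, IsProbabilityMeasure (μ k)]

/-- Configurations that part after level `k` share the coordinates up to `k` and have independent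
ones beyond: the second array is the first with its later coordinates resampled. -/
lemma lintegral_pair {α α' : Config Θ γ N} {k : Fin n}
    (heq : ∀ j ≤ k, α j = α' j) (hne : ∀ j, k < j → α.segment j ≠ α'.segment j)
    {F : (Fin N → Fin n → ℝ) → (Fin N → Fin n → ℝ) → ℝ≥0∞} (hF : Measurable (Function.uncurry F)) :
    ∫⁻ x, F (spinVector x α) (spinVector x α') ∂(siteMeasure Θ γ N μ) =
      ∫⁻ y, ∫⁻ z, F y (fun i => splice k (y i) (z i))
        ∂(Measure.pi fun _ : Fin N => Measure.pi μ) ∂(Measure.pi fun _ : Fin N => Measure.pi μ) := by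
  set J : Set (Fin n) := {j | ¬ j ≤ k} with hJ
  have hind := indepFun_spinVector μ α α' J fun j hj => hne j (not_le.1 hj)
  set r : (Fin N → Fin n → ℝ) → (Fin N → J → ℝ) := fun z i j => z i j with hr
  have hrm : Measurable r := measurable_pi_lambda _ fun i => measurable_pi_lambda _ fun j =>
    (measurable_pi_apply _).comp (measurable_pi_apply i)
  set G : (Fin N → Fin n → ℝ) × (Fin N → J → ℝ) → ℝ≥0∞ := fun p =>
    F p.1 (fun i j => if h : j ≤ k then p.1 i j else p.2 i ⟨j, h⟩) with hG
  have hjoin : Measurable fun (p : (Fin N → Fin n → ℝ) × (Fin N → J → ℝ)) (i : Fin N)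
      (j : Fin n) => if h : j ≤ k then p.1 i j else p.2 i ⟨j, h⟩ := by
    refine measurable_pi_lambda _ fun i => measurable_pi_lambda _ fun j => ?_
    by_cases hj : j ≤ k
    · simp only [hj, dite_true]; fun_prop
    · simp only [hj, dite_false]; fun_prop
  have hGm : Measurable G := hF.comp (measurable_fst.prodMk hjoin)
  have hsegeq : ∀ j ≤ k, α.segment j = α'.segment j := fun j hj =>
    (segment_eq_iff α α' j).2 fun l hl => heq l (hl.trans hj)
  have h1 : ∀ x : Site Θ γ N → ℝ, F (spinVector x α) (spinVector x α') =
      G (spinVector x α, r (spinVector x α')) := by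
    intro x
    simp only [hG, hr]
    congr 1
    funext i j
    by_cases hj : j ≤ k
    · simp only [dif_pos hj, spinVector, hsegeq j hj]
    · simp only [dif_neg hj]
  have hYm := measurable_spinVector α
  have hRm := hrm.comp (measurable_spinVector α')
  have hlaw := (indepFun_iff_map_prod_eq_prod_map_map hYm.aemeasurable hRm.aemeasurable).1 hind
  simp_rw [h1]
  have hR : (siteMeasure Θ γ N μ).map (r ∘ fun x => spinVector x α') =
      (Measure.pi fun _ : Fin N => Measure.pi μ).map r := by
    rw [← Measure.map_map hrm (measurable_spinVector α'), map_spinVector]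
  have hpr : IsProbabilityMeasure ((Measure.pi fun _ : Fin N => Measure.pi μ).map r) :=
    Measure.isProbabilityMeasure_map hrm.aemeasurable
  calc ∫⁻ x, G (spinVector x α, r (spinVector x α')) ∂(siteMeasure Θ γ N μ)
      = ∫⁻ p, G p ∂((siteMeasure Θ γ N μ).map
          fun x => (spinVector x α, (r ∘ fun x => spinVector x α') x)) :=
        (lintegral_map hGm (hYm.prodMk hRm)).symm
    _ = ∫⁻ y, ∫⁻ w, G (y, w) ∂((Measure.pi fun _ : Fin N => Measure.pi μ).map r)
          ∂(Measure.pi fun _ : Fin N => Measure.pi μ) := by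
        rw [hlaw, map_spinVector, hR, lintegral_prod _ hGm.aemeasurable]
    _ = _ := by
        refine lintegral_congr fun y => ?_
        rw [lintegral_map (f := fun w => G (y, w)) (hGm.comp measurable_prodMk_left) hrm]
        refine lintegral_congr fun z => ?_
        simp only [hG, hr]
        congr 1

/-- If `∏ φ ≥ c` and `∏ ψ_k ≤ d` on `A`, where `ψ_k` is the integral of `φ` over the coordinates
beyond `k`, then two configurations that agree exactly up to `k` are both in `A` with probability at
most `d / c` times that of being in `A`. -/
lemma siteMeasure_inter_mul_le {α α' : Config Θ γ N} {k : Fin n}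
    (heq : ∀ j ≤ k, α j = α' j) (hne : ∀ j, k < j → α.segment j ≠ α'.segment j)
    {φ : (Fin n → ℝ) → ℝ≥0∞} (hφ : Measurable φ) {A : Set (Fin N → Fin n → ℝ)}
    (hA : MeasurableSet A) {c d : ℝ≥0∞} (hc : ∀ y ∈ A, c ≤ ∏ i, φ (y i))
    (hd : ∀ y ∈ A, ∏ i, ∫⁻ z, φ (splice k (y i) z) ∂(Measure.pi μ) ≤ d) :
    c * siteMeasure Θ γ N μ ({x | spinVector x α ∈ A} ∩ {x | spinVector x α' ∈ A}) ≤
      d * (Measure.pi fun _ : Fin N => Measure.pi μ) A := by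
  have hAα : MeasurableSet {x : Site Θ γ N → ℝ | spinVector x α ∈ A} := measurable_spinVector α hA
  have hAα' : MeasurableSet {x : Site Θ γ N → ℝ | spinVector x α' ∈ A} := measurable_spinVector α' hA
  -- Membership of the second array in `A` is relaxed to `c ≤ ∏ φ`. Once the resampled coordinates
  -- are integrated out, the product factorises over `i` into section integrals.
  set F : (Fin N → Fin n → ℝ) → (Fin N → Fin n → ℝ) → ℝ≥0∞ :=
    fun y z => A.indicator 1 y * ∏ i, φ (z i) with hF
  have hFm : Measurable (Function.uncurry F) := by
    refine ((measurable_one.indicator hA).comp measurable_fst).mul ?_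
    exact Finset.measurable_prod _ fun i _ =>
      hφ.comp ((measurable_pi_apply i).comp measurable_snd)
  calc c * siteMeasure Θ γ N μ ({x | spinVector x α ∈ A} ∩ {x | spinVector x α' ∈ A})
      = ∫⁻ x, ({x | spinVector x α ∈ A} ∩ {x | spinVector x α' ∈ A}).indicator (fun _ => c) x
          ∂(siteMeasure Θ γ N μ) := by rw [lintegral_indicator_const (hAα.inter hAα')]
    _ ≤ ∫⁻ x, F (spinVector x α) (spinVector x α') ∂(siteMeasure Θ γ N μ) := by
        refine lintegral_mono fun x => ?_
        by_cases hx : x ∈ {x : Site Θ γ N → ℝ | spinVector x α ∈ A} ∩ {x | spinVector x α' ∈ A}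
        · rw [Set.indicator_of_mem hx]
          simp only [hF, Set.indicator_of_mem (show spinVector x α ∈ A from hx.1), Pi.one_apply,
            one_mul]
          exact hc _ hx.2
        · rw [Set.indicator_of_notMem hx]; exact zero_le
    _ = ∫⁻ y, ∫⁻ z, F y (fun i => splice k (y i) (z i))
        ∂(Measure.pi fun _ : Fin N => Measure.pi μ) ∂(Measure.pi fun _ : Fin N => Measure.pi μ) :=
        lintegral_pair μ heq hne hFm
    _ ≤ ∫⁻ y, A.indicator (fun _ => d) y ∂(Measure.pi fun _ : Fin N => Measure.pi μ) := by
        refine lintegral_mono fun y => ?_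
        by_cases hy : y ∈ A
        · simp only [hF, Set.indicator_of_mem hy, Pi.one_apply, one_mul]
          rw [lintegral_pi_prod (f := fun i z => φ (splice k (y i) z)) fun i =>
            hφ.comp ((measurable_splice k).comp measurable_prodMk_left)]
          exact hd y hy
        · simp [hF, Set.indicator_of_notMem hy]
    _ = d * (Measure.pi fun _ : Fin N => Measure.pi μ) A := lintegral_indicator_const hA _

end Pair

section Counting

lemma card_config : Fintype.card (Config Θ γ N) = ∏ k, branching Θ γ N k := by
  simp [Config, Fintype.card_pi]

lemma card_segment (k : Fin n) :
    Fintype.card (Segment Θ γ N k) = ∏ j ∈ Finset.Iic k, branching Θ γ N j := by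
  rw [Fintype.card_pi]
  simp only [Fintype.card_fin]
  exact (Finset.prod_subtype _ (fun j => Finset.mem_Iic) fun j => branching Θ γ N j).symm

/-- Replacing the initial segment of a configuration that agrees with `α` up to `k` by an arbitrary
one is injective, because the overwritten part is known from `α`. -/
lemma card_filter_agree_mul_le (α : Config Θ γ N) (k : Fin n)
    [DecidablePred fun α' : Config Θ γ N => ∀ j ≤ k, α j = α' j] :
    (Finset.univ.filter fun α' : Config Θ γ N => ∀ j ≤ k, α j = α' j).card *
      ∏ j ∈ Finset.Iic k, branching Θ γ N j ≤ Fintype.card (Config Θ γ N) := by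
  classical
  rw [← card_segment, ← Finset.card_univ (α := Segment Θ γ N k), ← Finset.card_product,
    ← Finset.card_univ (α := Config Θ γ N)]
  refine Finset.card_le_card_of_injOn
    (fun p j => if h : j ≤ k then p.2 ⟨j, h⟩ else p.1 j) (fun _ _ => Finset.mem_coe.2 (Finset.mem_univ _)) ?_
  rintro ⟨α₁, s₁⟩ h₁ ⟨α₂, s₂⟩ h₂ h
  simp only [Finset.coe_product, Set.mem_prod, Finset.mem_coe, Finset.mem_filter,
    Finset.mem_univ, true_and, and_true] at h₁ h₂
  have hj := fun j => congrFun h j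
  refine Prod.ext (funext fun j => ?_) (funext fun j => ?_)
  · by_cases hjk : j ≤ k
    · exact (h₁ j hjk).symm.trans (h₂ j hjk)
    · simpa [hjk] using hj j
  · simpa [j.2] using hj j.1

end Counting

end

/-! ### Second moment method for the number of hits. -/

section

variable {n : ℕ} {Θ : ℝ} {γ : Fin n → ℝ} {N : ℕ}

/-- The number of configurations `α` for which the array `(X_{α,i})_i` belongs to `A`. -/
noncomputable def hitCount (A : Set (Fin N → Fin n → ℝ)) (x : Site Θ γ N → ℝ) : ℝ :=
  ∑ α : Config Θ γ N, A.indicator (fun _ => (1 : ℝ)) (spinVector x α)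

section SecondMoment

variable (μ : Fin n → Measure ℝ) [∀ k, IsProbabilityMeasure (μ k)]
  {φ : (Fin n → ℝ) → ℝ≥0∞} {A : Set (Fin N → Fin n → ℝ)} {c : ℝ} {d : Fin n → ℝ}

lemma measurable_hitCount (hA : MeasurableSet A) :
    Measurable (hitCount (Θ := Θ) (γ := γ) A) :=
  Finset.measurable_sum _ fun α _ =>
    (measurable_const.indicator hA).comp (measurable_spinVector α)

lemma abs_hitCount_le (x : Site Θ γ N → ℝ) :
    |hitCount A x| ≤ Fintype.card (Config Θ γ N) := by
  refine (Finset.abs_sum_le_sum_abs _ _).trans ?_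
  calc ∑ α : Config Θ γ N, |A.indicator (fun _ => (1 : ℝ)) (spinVector x α)|
      ≤ ∑ _α : Config Θ γ N, (1 : ℝ) := Finset.sum_le_sum fun α _ => by
        by_cases h : spinVector x α ∈ A <;> simp [h]
    _ = _ := by simp

lemma integral_hitCount (hA : MeasurableSet A) :
    ∫ x, hitCount A x ∂(siteMeasure Θ γ N μ) =
      Fintype.card (Config Θ γ N) * (Measure.pi fun _ : Fin N => Measure.pi μ).real A := by
  have hi : ∀ α : Config Θ γ N, ∫ x, A.indicator (fun _ => (1 : ℝ)) (spinVector x α)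
      ∂(siteMeasure Θ γ N μ) = (Measure.pi fun _ : Fin N => Measure.pi μ).real A := fun α => by
    rw [← integral_map (f := A.indicator fun _ => (1 : ℝ)) (measurable_spinVector α).aemeasurable
      (measurable_const.indicator hA).aestronglyMeasurable, map_spinVector,
      integral_indicator_const _ hA]
    simp
  simp only [hitCount]
  have hint : ∀ α : Config Θ γ N, Integrable (fun x => A.indicator (fun _ => (1 : ℝ))
      (spinVector x α)) (siteMeasure Θ γ N μ) := fun α => integrable_of_abs_le
    ((measurable_const.indicator hA).comp (measurable_spinVector α)) (M := 1) (fun x => by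
      by_cases h : spinVector x α ∈ A <;> simp [h]) _
  rw [integral_finsetSum _ fun α _ => hint α]
  simp [hi]

/-- Only the last level of agreement is needed. Summing over all levels of agreement overcounts by
nonnegative terms, but allows the sum over pairs to be taken level by level. -/
lemma siteMeasure_inter_le (hφ : Measurable φ) (hA : MeasurableSet A) (hc0 : 0 < c)
    (hd0 : ∀ k, 0 ≤ d k) (hc : ∀ y ∈ A, ENNReal.ofReal c ≤ ∏ i, φ (y i))
    (hd : ∀ k, ∀ y ∈ A, ∏ i, ∫⁻ z, φ (splice k (y i) z) ∂(Measure.pi μ) ≤ ENNReal.ofReal (d k))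
    (α α' : Config Θ γ N) [∀ k, Decidable (∀ j ≤ k, α j = α' j)] :
    (siteMeasure Θ γ N μ).real ({x | spinVector x α ∈ A} ∩ {x | spinVector x α' ∈ A}) ≤
      (Measure.pi fun _ : Fin N => Measure.pi μ).real A ^ 2 +
      ∑ k, if ∀ j ≤ k, α j = α' j then
        d k / c * (Measure.pi fun _ : Fin N => Measure.pi μ).real A else 0 := by
  classical
  set p := (Measure.pi fun _ : Fin N => Measure.pi μ).real A with hp
  have hp0 : 0 ≤ p := measureReal_nonneg
  have hterm : ∀ k, 0 ≤ (if ∀ j ≤ k, α j = α' j then d k / c * p else 0) := fun k => by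
    split_ifs
    · exact mul_nonneg (div_nonneg (hd0 k) hc0.le) hp0
    · exact le_rfl
  set T : Finset (Fin n) := Finset.univ.filter fun k => ∀ j ≤ k, α j = α' j with hT
  rcases T.eq_empty_or_nonempty with hempty | hne
  · have hseg : ∀ j, α.segment j ≠ α'.segment j := fun j hj => by
      have : j ∈ T := by
        simp only [hT, Finset.mem_filter, Finset.mem_univ, true_and]
        exact (segment_eq_iff α α' j).1 hj
      rw [hempty] at this
      exact absurd this (Finset.notMem_empty j)
    rw [measureReal_def, siteMeasure_inter_of_segment_ne μ hseg hA, ENNReal.toReal_mul, sq]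
    exact le_add_of_nonneg_right (Finset.sum_nonneg fun k _ => hterm k)
  · set k := T.max' hne with hk
    have hkT : ∀ j ≤ k, α j = α' j := (Finset.mem_filter.1 (T.max'_mem hne)).2
    have hseg : ∀ j, k < j → α.segment j ≠ α'.segment j := fun j hj h => by
      have : j ∈ T := by
        simp only [hT, Finset.mem_filter, Finset.mem_univ, true_and]
        exact (segment_eq_iff α α' j).1 h
      exact absurd (T.le_max' j this) (not_le.2 hj)
    have h1 := siteMeasure_inter_mul_le μ hkT hseg hφ hA hc (hd k)
    have h2 := ENNReal.toReal_mono (ENNReal.mul_ne_top ENNReal.ofReal_ne_top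
      (measure_ne_top _ _)) h1
    rw [ENNReal.toReal_mul, ENNReal.toReal_mul, ENNReal.toReal_ofReal hc0.le,
      ENNReal.toReal_ofReal (hd0 k)] at h2
    have h3 : (siteMeasure Θ γ N μ).real ({x | spinVector x α ∈ A} ∩ {x | spinVector x α' ∈ A}) ≤
        d k / c * p := by
      rw [div_mul_eq_mul_div, le_div_iff₀ hc0, mul_comm]
      exact h2
    refine h3.trans ?_
    have h4 := Finset.single_le_sum (fun k _ => hterm k) (Finset.mem_univ k)
    simp only [if_pos hkT] at h4
    have := sq_nonneg p
    linarith

lemma integral_hitCount_sq_le (hφ : Measurable φ) (hA : MeasurableSet A) (hc0 : 0 < c)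
    (hd0 : ∀ k, 0 ≤ d k) (hc : ∀ y ∈ A, ENNReal.ofReal c ≤ ∏ i, φ (y i))
    (hd : ∀ k, ∀ y ∈ A, ∏ i, ∫⁻ z, φ (splice k (y i) z) ∂(Measure.pi μ) ≤ ENNReal.ofReal (d k))
    (hbr : ∀ k, 0 < branching Θ γ N k) :
    ∫ x, hitCount A x ^ 2 ∂(siteMeasure Θ γ N μ) ≤
      (Fintype.card (Config Θ γ N) : ℝ) ^ 2 *
        ((Measure.pi fun _ : Fin N => Measure.pi μ).real A ^ 2 +
        ∑ k, d k / (c * ∏ j ∈ Finset.Iic k, (branching Θ γ N j : ℝ)) *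
          (Measure.pi fun _ : Fin N => Measure.pi μ).real A) := by
  classical
  set p := (Measure.pi fun _ : Fin N => Measure.pi μ).real A with hp
  set M : ℝ := (Fintype.card (Config Θ γ N) : ℝ) with hM
  have hp0 : 0 ≤ p := measureReal_nonneg
  have hexp : ∀ x : Site Θ γ N → ℝ, hitCount A x ^ 2 =
      ∑ α : Config Θ γ N, ∑ α' : Config Θ γ N,
        ({x : Site Θ γ N → ℝ | spinVector x α ∈ A} ∩ {x | spinVector x α' ∈ A}).indicator
          (fun _ => (1 : ℝ)) x := by
    intro x
    rw [hitCount, sq, Finset.sum_mul_sum]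
    refine Finset.sum_congr rfl fun α _ => Finset.sum_congr rfl fun α' _ => ?_
    by_cases h1 : spinVector x α ∈ A <;> by_cases h2 : spinVector x α' ∈ A <;>
      simp [Set.indicator, h1, h2]
  have hms : ∀ α α' : Config Θ γ N, MeasurableSet
      ({x : Site Θ γ N → ℝ | spinVector x α ∈ A} ∩ {x | spinVector x α' ∈ A}) := fun α α' =>
    (measurable_spinVector α hA).inter (measurable_spinVector α' hA)
  have hint : ∀ α α' : Config Θ γ N, Integrable
      (({x : Site Θ γ N → ℝ | spinVector x α ∈ A} ∩ {x | spinVector x α' ∈ A}).indicator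
          (fun _ => (1 : ℝ))) (siteMeasure Θ γ N μ) := fun α α' =>
    (integrable_const _).indicator (hms α α')
  simp_rw [hexp]
  rw [integral_finsetSum _ fun α _ => integrable_finsetSum _ fun α' _ => hint α α']
  simp_rw [integral_finsetSum _ fun α' _ => hint _ α', integral_indicator_const _ (hms _ _),
    smul_eq_mul, mul_one]
  calc ∑ α : Config Θ γ N, ∑ α' : Config Θ γ N, (siteMeasure Θ γ N μ).real
        ({x : Site Θ γ N → ℝ | spinVector x α ∈ A} ∩ {x | spinVector x α' ∈ A})
      ≤ ∑ α : Config Θ γ N, ∑ α' : Config Θ γ N,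
          (p ^ 2 + ∑ k, if ∀ j ≤ k, α j = α' j then d k / c * p else 0) :=
        Finset.sum_le_sum fun α _ => Finset.sum_le_sum fun α' _ =>
          siteMeasure_inter_le μ hφ hA hc0 hd0 hc hd α α'
    _ ≤ ∑ _α : Config Θ γ N, M * (p ^ 2 +
          ∑ k, d k / (c * ∏ j ∈ Finset.Iic k, (branching Θ γ N j : ℝ)) * p) := by
        refine Finset.sum_le_sum fun α _ => ?_
        rw [Finset.sum_add_distrib, Finset.sum_comm, mul_add, Finset.mul_sum]
        refine add_le_add (by simp [hM]) (Finset.sum_le_sum fun k _ => ?_)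
        rw [← Finset.sum_filter, Finset.sum_const, nsmul_eq_mul]
        have hcard : ((Finset.univ.filter fun α' : Config Θ γ N => ∀ j ≤ k, α j = α' j).card : ℝ) *
            ∏ j ∈ Finset.Iic k, (branching Θ γ N j : ℝ) ≤ M := by
          rw [hM]; exact_mod_cast card_filter_agree_mul_le α k
        have hprod : 0 < ∏ j ∈ Finset.Iic k, (branching Θ γ N j : ℝ) :=
          Finset.prod_pos fun j _ => by exact_mod_cast hbr j
        rw [← le_div_iff₀ hprod] at hcard
        calc _ ≤ M / (∏ j ∈ Finset.Iic k, (branching Θ γ N j : ℝ)) * (d k / c * p) :=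
              mul_le_mul_of_nonneg_right hcard (mul_nonneg (div_nonneg (hd0 k) hc0.le) hp0)
          _ = _ := by field_simp
    _ = _ := by
        rw [Finset.sum_const, Finset.card_univ, nsmul_eq_mul]
        ring

/-- The second moment method for the number of configurations whose array belongs to `A`. -/
lemma siteMeasure_hitCount_lt_le (hφ : Measurable φ) (hA : MeasurableSet A) (hc0 : 0 < c)
    (hd0 : ∀ k, 0 ≤ d k) (hc : ∀ y ∈ A, ENNReal.ofReal c ≤ ∏ i, φ (y i))
    (hd : ∀ k, ∀ y ∈ A, ∏ i, ∫⁻ z, φ (splice k (y i) z) ∂(Measure.pi μ) ≤ ENNReal.ofReal (d k))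
    (hbr : ∀ k, 0 < branching Θ γ N k)
    (hp : 0 < (Measure.pi fun _ : Fin N => Measure.pi μ).real A) :
    siteMeasure Θ γ N μ {x | hitCount A x < Fintype.card (Config Θ γ N) *
        (Measure.pi fun _ : Fin N => Measure.pi μ).real A / 2} ≤
      ENNReal.ofReal (4 * ∑ k, d k / (c * (Measure.pi fun _ : Fin N => Measure.pi μ).real A *
        ∏ j ∈ Finset.Iic k, (branching Θ γ N j : ℝ))) := by
  set p := (Measure.pi fun _ : Fin N => Measure.pi μ).real A with hpdef
  set M : ℝ := (Fintype.card (Config Θ γ N) : ℝ) with hM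
  have hMpos : 0 < M := by
    rw [hM, card_config]
    exact_mod_cast Finset.prod_pos fun k _ => hbr k
  have hL2 : MemLp (hitCount A) 2 (siteMeasure Θ γ N μ) :=
    MemLp.of_bound (measurable_hitCount hA).aestronglyMeasurable M
      (ae_of_all _ fun x => abs_hitCount_le x)
  -- Chebyshev at half the mean. The `p ^ 2` term of the second moment cancels against the squared
  -- mean, so only the correlated pairs remain.
  have hcheb := meas_ge_le_variance_div_sq hL2 (c := M * p / 2) (by positivity)
  rw [integral_hitCount μ hA] at hcheb
  refine (measure_mono fun x hx => ?_).trans (hcheb.trans (ENNReal.ofReal_le_ofReal ?_))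
  · simp only [Set.mem_ofPred_eq] at hx ⊢
    rw [abs_sub_comm]
    exact le_trans (by linarith) (le_abs_self _)
  · have hvar : Var[hitCount A; siteMeasure Θ γ N μ] ≤
        M ^ 2 * ∑ k, d k / (c * ∏ j ∈ Finset.Iic k, (branching Θ γ N j : ℝ)) * p := by
      rw [variance_eq_sub hL2, integral_hitCount μ hA]
      have := integral_hitCount_sq_le (Θ := Θ) (γ := γ) μ hφ hA hc0 hd0 hc hd hbr
      simp only [Pi.pow_apply]
      linarith
    rw [div_le_iff₀ (by positivity)]
    refine hvar.trans (le_of_eq ?_)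
    rw [Finset.mul_sum, Finset.mul_sum, Finset.sum_mul]
    refine Finset.sum_congr rfl fun k _ => ?_
    have hprod : 0 < ∏ j ∈ Finset.Iic k, (branching Θ γ N j : ℝ) :=
      Finset.prod_pos fun j _ => by exact_mod_cast hbr j
    field_simp
    norm_num

end SecondMoment

end

/-! ### Marginal densities, laws of large numbers and typical sets. -/

section

section Marginal

variable {n : ℕ} (μ : Fin n → Measure ℝ)

/-- The integral of `φ` over the coordinates beyond `k`. -/
noncomputable def sectionMass (φ : (Fin n → ℝ) → ℝ≥0∞) (k : Fin n) (y : Fin n → ℝ) : ℝ≥0∞ :=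
  ∫⁻ z, φ (splice k y z) ∂(Measure.pi μ)

/-- The extension by zero of a vector of the first coordinates. -/
noncomputable def extendZero (k : Fin n) (u : {j : Fin n // j ≤ k} → ℝ) : Fin n → ℝ :=
  fun j => if h : j ≤ k then u ⟨j, h⟩ else 0

lemma measurable_extendZero (k : Fin n) : Measurable (extendZero k) := by
  refine measurable_pi_lambda _ fun j => ?_
  by_cases hj : j ≤ k
  · simp only [extendZero, hj, dite_true]; fun_prop
  · simp only [extendZero, hj, dite_false]; fun_prop

lemma measurable_restrictLE (k : Fin n) :
    Measurable fun (y : Fin n → ℝ) (i : {j // j ≤ k}) => y i.1 :=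
  measurable_pi_lambda _ fun _ => measurable_pi_apply _

/-- The section integral reads only the coordinates up to `k`, so the zeros filled in are immaterial
and it descends to a function of the marginal variables. -/
lemma sectionMass_extendZero (φ : (Fin n → ℝ) → ℝ≥0∞) (k : Fin n) (y : Fin n → ℝ) :
    sectionMass μ φ k (extendZero k fun j => y j.1) = sectionMass μ φ k y := by
  unfold sectionMass
  refine lintegral_congr fun z => ?_
  congr 1
  funext j
  by_cases hj : j ≤ k <;> simp [splice, extendZero, hj]

variable [∀ k, IsProbabilityMeasure (μ k)]

lemma map_splice (k : Fin n) :
    ((Measure.pi μ).prod (Measure.pi μ)).map (fun p => splice k p.1 p.2) = Measure.pi μ := by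
  refine (Measure.pi_eq fun s hs => ?_).symm
  rw [Measure.map_apply (measurable_splice k) (MeasurableSet.univ_pi hs)]
  have h : (fun p : (Fin n → ℝ) × (Fin n → ℝ) => splice k p.1 p.2) ⁻¹' Set.univ.pi s =
      (Set.univ.pi fun j => if j ≤ k then s j else Set.univ) ×ˢ
        (Set.univ.pi fun j => if j ≤ k then Set.univ else s j) := by
    ext p
    simp only [Set.mem_preimage, Set.mem_pi, Set.mem_univ, true_imp_iff, Set.mem_prod, splice,
      ← forall_and]
    refine forall_congr' fun j => ?_
    by_cases hj : j ≤ k <;> simp [hj]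
  rw [h, Measure.prod_prod, Measure.pi_pi, Measure.pi_pi, ← Finset.prod_mul_distrib]
  refine Finset.prod_congr rfl fun j _ => ?_
  by_cases hj : j ≤ k <;> simp [hj]

variable {φ : (Fin n → ℝ) → ℝ≥0∞}

lemma measurable_sectionMass (hφ : Measurable φ) (k : Fin n) :
    Measurable (sectionMass μ φ k) :=
  (hφ.comp (measurable_splice k)).lintegral_prod_right'

lemma sectionMass_eq_self {k : Fin n} (hk : ∀ j : Fin n, j ≤ k) : sectionMass μ φ k = φ := by
  funext y
  have h : ∀ z, splice k y z = y := fun z => funext fun j => if_pos (hk j)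
  simp [sectionMass, h]

/-- Splicing two independent samples of `Measure.pi μ` gives another sample (`map_splice`). An event
on the first coordinates sees only the first sample, so the second can be integrated out. -/
lemma marginal_withDensity (hφ : Measurable φ) (k : Fin n) :
    marginal k ((Measure.pi μ).withDensity φ) =
      (marginal k (Measure.pi μ)).withDensity fun u => sectionMass μ φ k (extendZero k u) := by
  have hπ := measurable_restrictLE k
  have hψ : Measurable fun u => sectionMass μ φ k (extendZero k u) :=
    (measurable_sectionMass μ hφ k).comp (measurable_extendZero k)
  ext B hB
  rw [withDensity_apply _ hB, marginal, marginal, Measure.map_apply hπ hB,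
    withDensity_apply _ (hπ hB), Measure.restrict_map hπ hB, lintegral_map hψ hπ,
    ← lintegral_indicator (hπ hB), ← lintegral_indicator (hπ hB)]
  simp only [sectionMass_extendZero]
  set C := (fun (y : Fin n → ℝ) (j : {j : Fin n // j ≤ k}) => y j.1) ⁻¹' B with hC
  have hCm : MeasurableSet C := hπ hB
  have hCs : ∀ y z, splice k y z ∈ C ↔ y ∈ C := fun y z => by
    have : (fun j : {j : Fin n // j ≤ k} => splice k y z j.1) = fun j => y j.1 :=
      funext fun j => if_pos j.2
    simp only [hC, Set.mem_preimage, this]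
  have hm : Measurable (C.indicator φ) := hφ.indicator hCm
  conv_lhs => rw [← map_splice μ k]
  rw [lintegral_map hm (measurable_splice k),
    lintegral_prod (fun p => C.indicator φ (splice k p.1 p.2))
      (hm.comp (measurable_splice k)).aemeasurable]
  refine lintegral_congr fun y => ?_
  by_cases hy : y ∈ C
  · rw [Set.indicator_of_mem hy]
    exact lintegral_congr fun z => Set.indicator_of_mem ((hCs y z).2 hy) φ
  · rw [Set.indicator_of_notMem hy]
    have : ∀ z, C.indicator φ (splice k y z) = 0 := fun z =>
      Set.indicator_of_notMem (mt (hCs y z).1 hy) φ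
    simp [this]

instance (k : Fin n) (ν : Measure (Fin n → ℝ)) [IsProbabilityMeasure ν] :
    IsProbabilityMeasure (marginal k ν) :=
  Measure.isProbabilityMeasure_map (measurable_restrictLE k).aemeasurable

lemma sectionMass_ne_top (hφ : Measurable φ) [IsProbabilityMeasure ((Measure.pi μ).withDensity φ)]
    (k : Fin n) : ∀ᵐ y ∂((Measure.pi μ).withDensity φ), sectionMass μ φ k y ≠ ∞ := by
  refine (withDensity_absolutelyContinuous _ φ).ae_le ?_
  have hint : ∫⁻ y, sectionMass μ φ k y ∂(Measure.pi μ) ≠ ∞ := by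
    have h := measure_ne_top (marginal k ((Measure.pi μ).withDensity φ)) Set.univ
    have hψ : Measurable fun u => sectionMass μ φ k (extendZero k u) :=
      (measurable_sectionMass μ hφ k).comp (measurable_extendZero k)
    rw [marginal_withDensity μ hφ k, withDensity_apply _ MeasurableSet.univ,
      Measure.restrict_univ, marginal, lintegral_map hψ (measurable_restrictLE k)] at h
    simpa only [sectionMass_extendZero] using h
  filter_upwards [ae_lt_top (measurable_sectionMass μ hφ k) hint] with y hy using hy.ne

/-- The relative entropy of the marginals is the mean of the logarithm of the marginal density. -/
lemma klDiv_marginal (hφ : Measurable φ) [IsProbabilityMeasure ((Measure.pi μ).withDensity φ)]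
    {k : Fin n}
    (hk : klDiv (marginal k ((Measure.pi μ).withDensity φ)) (marginal k (Measure.pi μ)) ≠ ∞) :
    Integrable (fun y => Real.log (sectionMass μ φ k y).toReal) ((Measure.pi μ).withDensity φ) ∧
    (klDiv (marginal k ((Measure.pi μ).withDensity φ)) (marginal k (Measure.pi μ))).toReal =
      ∫ y, Real.log (sectionMass μ φ k y).toReal ∂((Measure.pi μ).withDensity φ) := by
  have hπ := measurable_restrictLE k
  have hψ : Measurable fun u => sectionMass μ φ k (extendZero k u) :=
    (measurable_sectionMass μ hφ k).comp (measurable_extendZero k)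
  obtain ⟨hac, hint⟩ := klDiv_ne_top_iff.1 hk
  have hrn : (marginal k ((Measure.pi μ).withDensity φ)).rnDeriv (marginal k (Measure.pi μ))
      =ᵐ[marginal k ((Measure.pi μ).withDensity φ)]
        fun u => sectionMass μ φ k (extendZero k u) := by
    refine hac.ae_le ?_
    rw [marginal_withDensity μ hφ k]
    exact Measure.rnDeriv_withDensity _ hψ
  have hllr : llr (marginal k ((Measure.pi μ).withDensity φ)) (marginal k (Measure.pi μ))
      =ᵐ[marginal k ((Measure.pi μ).withDensity φ)]
        fun u => Real.log (sectionMass μ φ k (extendZero k u)).toReal := by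
    filter_upwards [hrn] with u hu
    rw [llr, hu]
  have hm : Measurable fun u => Real.log (sectionMass μ φ k (extendZero k u)).toReal :=
    hψ.ennreal_toReal.log
  have hint' := hint.congr hllr
  constructor
  · rw [marginal, integrable_map_measure hm.aestronglyMeasurable hπ.aemeasurable] at hint'
    refine hint'.congr (ae_of_all _ fun y => ?_)
    simp only [Function.comp, sectionMass_extendZero]
  · rw [toReal_klDiv_of_measure_eq hac (by simp), integral_congr_ae hllr]
    conv_lhs => rw [marginal]
    rw [integral_map hπ.aemeasurable hm.aestronglyMeasurable]
    simp only [sectionMass_extendZero]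

end Marginal

section LargeNumbers

variable {E : Type*} [MeasurableSpace E] (ν : Measure E) [IsProbabilityMeasure ν]

lemma ae_tendsto_average {f : E → ℝ} (hf : Measurable f) (hi : Integrable f ν) :
    ∀ᵐ ω ∂(Measure.infinitePi fun _ : ℕ => ν),
      Tendsto (fun N : ℕ => ((N + 1 : ℕ) : ℝ)⁻¹ * ∑ i : Fin (N + 1), f (ω i)) atTop
        (𝓝 (∫ x, f x ∂ν)) := by
  have hmp : ∀ i, MeasurePreserving (fun ω : ℕ → E => ω i) (Measure.infinitePi fun _ : ℕ => ν) ν :=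
    fun i => measurePreserving_eval_infinitePi (fun _ : ℕ => ν) i
  have hind : iIndepFun (fun (i : ℕ) (ω : ℕ → E) => f (ω i)) (Measure.infinitePi fun _ : ℕ => ν) :=
    iIndepFun_infinitePi (P := fun _ : ℕ => ν) (X := fun _ => f) fun _ => hf
  have hid : ∀ i, IdentDistrib (fun ω : ℕ → E => f (ω i)) (fun ω : ℕ → E => f (ω 0))
      (Measure.infinitePi fun _ : ℕ => ν) (Measure.infinitePi fun _ : ℕ => ν) := fun i => by
    have h : IdentDistrib (fun ω : ℕ → E => ω i) (fun ω : ℕ → E => ω 0)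
        (Measure.infinitePi fun _ : ℕ => ν) (Measure.infinitePi fun _ : ℕ => ν) :=
      ⟨(hmp i).measurable.aemeasurable, (hmp 0).measurable.aemeasurable,
        (hmp i).map_eq.trans (hmp 0).map_eq.symm⟩
    exact h.comp hf
  have hint : Integrable (fun ω : ℕ → E => f (ω 0)) (Measure.infinitePi fun _ : ℕ => ν) :=
    (hmp 0).integrable_comp_of_integrable hi
  have hval : ∫ ω, f (ω 0) ∂(Measure.infinitePi fun _ : ℕ => ν) = ∫ x, f x ∂ν := by
    rw [← (hmp 0).map_eq, integral_map (hmp 0).measurable.aemeasurable hf.aestronglyMeasurable]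
    rw [(hmp 0).map_eq]
  have h := strong_law_ae_real (fun (i : ℕ) (ω : ℕ → E) => f (ω i)) hint
    (fun i j hij => hind.indepFun hij) hid
  filter_upwards [h] with ω hω
  rw [← hval]
  refine ((tendsto_add_atTop_iff_nat 1).2 hω).congr fun N => ?_
  rw [Finset.sum_range (fun i => f (ω i)), div_eq_inv_mul]

lemma map_infinitePi_fin (N : ℕ) :
    (Measure.infinitePi fun _ : ℕ => ν).map (fun (ω : ℕ → E) (i : Fin N) => ω i) =
      Measure.pi fun _ : Fin N => ν := by
  have hind : iIndepFun (fun (i : ℕ) (ω : ℕ → E) => ω i) (Measure.infinitePi fun _ : ℕ => ν) :=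
    iIndepFun_infinitePi (P := fun _ : ℕ => ν) (X := fun _ x => x) fun _ => measurable_id
  have h := (iIndepFun_iff_map_fun_eq_pi_map fun i : Fin N =>
    (measurable_pi_apply (i : ℕ)).aemeasurable).1 (hind.precomp Fin.val_injective)
  rw [h]
  congr 1
  funext i
  exact (measurePreserving_eval_infinitePi (fun _ : ℕ => ν) i).map_eq

/-- Empirical measures of independent variables converge weakly to the common law. -/
lemma ae_eventually_empirical_mem [TopologicalSpace E] [OpensMeasurableSpace E]
    (ν : ProbabilityMeasure E) {s : Set (ProbabilityMeasure E)} (hs : s ∈ 𝓝 ν) :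
    ∀ᵐ ω ∂(Measure.infinitePi fun _ : ℕ => (ν : Measure E)),
      ∀ᶠ N : ℕ in atTop, empirical (fun i : Fin (N + 1) => ω i) ∈ s := by
  -- The null set depends on the test function. Taking "almost surely eventually in `s`" itself as a
  -- filter lets weak convergence be tested one function at a time, without a countable determining
  -- class.
  set l : Filter (ProbabilityMeasure E) :=
    { sets := {s | ∀ᵐ ω ∂(Measure.infinitePi fun _ : ℕ => (ν : Measure E)),
        ∀ᶠ N : ℕ in atTop, empirical (fun i : Fin (N + 1) => ω i) ∈ s}
      univ_sets := by simp
      sets_of_superset := fun {s t} hs hst => by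
        simp only [Set.mem_ofPred_eq] at hs ⊢
        filter_upwards [hs] with ω hω
        filter_upwards [hω] with N hN using hst hN
      inter_sets := fun {s t} hs ht => by
        simp only [Set.mem_ofPred_eq] at hs ht ⊢
        filter_upwards [hs, ht] with ω h1 h2
        filter_upwards [h1, h2] with N h3 h4 using ⟨h3, h4⟩ } with hl
  suffices h : Tendsto id l (𝓝 ν) from h hs
  rw [ProbabilityMeasure.tendsto_iff_forall_integral_tendsto]
  intro f t ht
  change ∀ᵐ ω ∂(Measure.infinitePi fun _ : ℕ => (ν : Measure E)),
    ∀ᶠ N : ℕ in atTop, ∫ x, f x ∂(empirical (fun i : Fin (N + 1) => ω i) : Measure E) ∈ t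
  filter_upwards [ae_tendsto_average (ν : Measure E) f.continuous.measurable
    (f.integrable _)] with ω hω
  filter_upwards [hω ht] with N hN
  rw [integral_empirical _ f.continuous.measurable]
  exact hN

lemma eventually_half_le_pi {A : (N : ℕ) → Set (Fin (N + 1) → E)}
    (hA : ∀ N, MeasurableSet (A N))
    (h : ∀ᵐ ω ∂(Measure.infinitePi fun _ : ℕ => ν),
      ∀ᶠ N : ℕ in atTop, (fun i : Fin (N + 1) => ω i) ∈ A N) :
    ∀ᶠ N : ℕ in atTop, 2⁻¹ ≤ (Measure.pi fun _ : Fin (N + 1) => ν) (A N) := by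
  have hm : ∀ N : ℕ, Measurable fun (ω : ℕ → E) (i : Fin (N + 1)) => ω i := fun N =>
    measurable_pi_lambda _ fun i => measurable_pi_apply _
  have ht := tendsto_measure_of_ae_tendsto_indicator_of_isFiniteMeasure
    (μ := Measure.infinitePi fun _ : ℕ => ν) atTop (A := Set.univ)
    (As := fun N => (fun (ω : ℕ → E) (i : Fin (N + 1)) => ω i) ⁻¹' A N) MeasurableSet.univ
    (fun N => hm N (hA N)) (by
      filter_upwards [h] with ω hω
      filter_upwards [hω] with N hN
      simpa using hN)
  rw [measure_univ] at ht
  have h2 : (2⁻¹ : ℝ≥0∞) < 1 := by simp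
  filter_upwards [ht.eventually_const_lt h2] with N hN
  rw [← map_infinitePi_fin, Measure.map_apply (hm N) (hA N)]
  exact hN.le

end LargeNumbers

section Typical

/-- Since `Real.log 0 = 0`, a factor 0 is replaced by 1 on the right, which is harmless for an upper
bound. An infinite factor would also become 1, which is why it is excluded here; the next lemma has
the roles reversed. -/
lemma prod_le_ofReal_exp {ι : Type*} (s : Finset ι) {x : ι → ℝ≥0∞} (h : ∀ i ∈ s, x i ≠ ∞) :
    ∏ i ∈ s, x i ≤ ENNReal.ofReal (Real.exp (∑ i ∈ s, Real.log (x i).toReal)) := by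
  rw [Real.exp_sum, ENNReal.ofReal_prod_of_nonneg fun i _ => (Real.exp_pos _).le]
  refine Finset.prod_le_prod' fun i hi => ?_
  rcases eq_or_ne (x i) 0 with h0 | h0
  · simp [h0]
  · rw [Real.exp_log (ENNReal.toReal_pos h0 (h i hi)), ENNReal.ofReal_toReal (h i hi)]

lemma ofReal_exp_le_prod {ι : Type*} (s : Finset ι) {x : ι → ℝ≥0∞} (h0 : ∀ i ∈ s, x i ≠ 0) :
    ENNReal.ofReal (Real.exp (∑ i ∈ s, Real.log (x i).toReal)) ≤ ∏ i ∈ s, x i := by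
  rw [Real.exp_sum, ENNReal.ofReal_prod_of_nonneg fun i _ => (Real.exp_pos _).le]
  refine Finset.prod_le_prod' fun i hi => ?_
  by_cases h : x i = ∞
  · simp [h]
  · rw [Real.exp_log (ENNReal.toReal_pos (h0 i hi) h), ENNReal.ofReal_toReal h]

variable {n : ℕ} (μ : Fin n → Measure ℝ) [∀ k, IsProbabilityMeasure (μ k)]
  (φ : (Fin n → ℝ) → ℝ≥0∞)

/-- The arrays of `N` vectors whose empirical measure is in `U` and along which the products of the
density `φ` and of its sections have the growth rates `h` and `H`, up to `δ`. -/
def typicalSet (U : Set (ProbabilityMeasure (Fin n → ℝ))) (H : Fin n → ℝ) (h δ : ℝ) (N : ℕ)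
    [NeZero N] : Set (Fin N → Fin n → ℝ) :=
  {y | empirical y ∈ U ∧
    (∀ k, ∏ i, sectionMass μ φ k (y i) ≤ ENNReal.ofReal (Real.exp (N * (H k + δ)))) ∧
    ENNReal.ofReal (Real.exp (N * (h - δ))) ≤ ∏ i, φ (y i) ∧
    ∏ i, φ (y i) ≤ ENNReal.ofReal (Real.exp (N * (h + δ)))}

variable {φ}

lemma measurableSet_typicalSet (hφ : Measurable φ) {U : Set (ProbabilityMeasure (Fin n → ℝ))}
    (hU : IsOpen U) (H : Fin n → ℝ) (h δ : ℝ) (N : ℕ) [NeZero N] :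
    MeasurableSet (typicalSet μ φ U H h δ N) := by
  have hp : Measurable fun y : Fin N → Fin n → ℝ => ∏ i, φ (y i) :=
    Finset.measurable_prod _ fun i _ => hφ.comp (measurable_pi_apply i)
  have hpk : ∀ k, Measurable fun y : Fin N → Fin n → ℝ => ∏ i, sectionMass μ φ k (y i) := fun k =>
    Finset.measurable_prod _ fun i _ =>
      (measurable_sectionMass μ hφ k).comp (measurable_pi_apply i)
  refine (continuous_empirical.isOpen_preimage U hU).measurableSet.inter
    (MeasurableSet.inter ?_ ((measurableSet_le measurable_const hp).inter
      (measurableSet_le hp measurable_const)))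
  change MeasurableSet {y : Fin N → Fin n → ℝ | ∀ k, ∏ i, sectionMass μ φ k (y i) ≤
    ENNReal.ofReal (Real.exp (N * (H k + δ)))}
  rw [Set.ofPred_forall]
  exact MeasurableSet.iInter fun k => measurableSet_le (hpk k) measurable_const

/-- Under the product of copies of `ν` the typical set has probability at least 1/2 by the law of
large numbers. On it the density of that product is at most `exp (N (h + δ))`, and changing measure
gives the bound. -/
lemma eventually_typicalSet (hφ : Measurable φ) (ν : ProbabilityMeasure (Fin n → ℝ))
    (hν : (ν : Measure (Fin n → ℝ)) = (Measure.pi μ).withDensity φ)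
    (hi : Integrable (fun y => Real.log (φ y).toReal) (ν : Measure (Fin n → ℝ)))
    (hik : ∀ k, Integrable (fun y => Real.log (sectionMass μ φ k y).toReal)
      (ν : Measure (Fin n → ℝ)))
    {U : Set (ProbabilityMeasure (Fin n → ℝ))} (hU : IsOpen U) (hνU : ν ∈ U) {δ : ℝ} (hδ : 0 < δ) :
    ∀ᶠ N : ℕ in atTop,
      Real.exp (-(((N + 1 : ℕ) : ℝ) *
        (∫ y, Real.log (φ y).toReal ∂(ν : Measure (Fin n → ℝ)) + δ))) / 2 ≤
      (Measure.pi fun _ : Fin (N + 1) => Measure.pi μ).real (typicalSet μ φ U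
        (fun k => ∫ y, Real.log (sectionMass μ φ k y).toReal ∂(ν : Measure (Fin n → ℝ)))
        (∫ y, Real.log (φ y).toReal ∂(ν : Measure (Fin n → ℝ))) δ (N + 1)) := by
  set H : Fin n → ℝ := fun k => ∫ y, Real.log (sectionMass μ φ k y).toReal
    ∂(ν : Measure (Fin n → ℝ)) with hH
  set h : ℝ := ∫ y, Real.log (φ y).toReal ∂(ν : Measure (Fin n → ℝ)) with hh
  have hpr : IsProbabilityMeasure ((Measure.pi μ).withDensity φ) := hν ▸ inferInstance
  have hφ0 : ∀ᵐ y ∂(ν : Measure (Fin n → ℝ)), φ y ≠ 0 := by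
    rw [hν, ae_withDensity_iff hφ]
    exact ae_of_all _ fun y hy => hy
  have hφtop : ∀ᵐ y ∂(ν : Measure (Fin n → ℝ)), φ y ≠ ∞ := by
    rw [hν]
    refine (withDensity_absolutelyContinuous _ φ).ae_le ?_
    have hint : ∫⁻ y, φ y ∂(Measure.pi μ) ≠ ∞ := by
      have := measure_ne_top ((Measure.pi μ).withDensity φ) Set.univ
      rwa [withDensity_apply _ MeasurableSet.univ, Measure.restrict_univ] at this
    filter_upwards [ae_lt_top hφ hint] with y hy using hy.ne
  have hψtop : ∀ k, ∀ᵐ y ∂(ν : Measure (Fin n → ℝ)), sectionMass μ φ k y ≠ ∞ := fun k => by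
    rw [hν]; exact sectionMass_ne_top μ hφ k
  have hall : ∀ {p : (Fin n → ℝ) → Prop}, (∀ᵐ y ∂(ν : Measure (Fin n → ℝ)), p y) →
      ∀ᵐ ω ∂(Measure.infinitePi fun _ : ℕ => (ν : Measure (Fin n → ℝ))), ∀ i, p (ω i) := by
    intro p hp
    refine ae_all_iff.2 fun i => ?_
    exact (measurePreserving_eval_infinitePi (fun _ : ℕ => (ν : Measure (Fin n → ℝ))) i).quasiMeasurePreserving.ae hp
  have hev := eventually_half_le_pi (ν : Measure (Fin n → ℝ))
    (A := fun N => typicalSet μ φ U H h δ (N + 1))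
    (fun N => measurableSet_typicalSet μ hφ hU H h δ (N + 1)) (by
      have hk := fun k => ae_tendsto_average (ν : Measure (Fin n → ℝ))
        (measurable_sectionMass μ hφ k).ennreal_toReal.log (hik k)
      filter_upwards [ae_eventually_empirical_mem ν (hU.mem_nhds hνU), ae_all_iff.2 hk,
        ae_tendsto_average (ν : Measure (Fin n → ℝ)) hφ.ennreal_toReal.log hi,
        hall hφ0, hall hφtop, ae_all_iff.2 fun k => hall (hψtop k)] with ω h1 h2 h3 h4 h5 h6
      have h2' : ∀ᶠ N : ℕ in atTop, ∀ k, ((N + 1 : ℕ) : ℝ)⁻¹ *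
          ∑ i : Fin (N + 1), Real.log (sectionMass μ φ k (ω i)).toReal < H k + δ :=
        eventually_all.2 fun k => (h2 k).eventually_lt_const (by simp only [hH]; linarith)
      filter_upwards [h1, h2', h3.eventually_lt_const (show h < h + δ by linarith),
        h3.eventually_const_lt (show h - δ < h by linarith)] with N g1 g2 g3 g4
      have hN : (0 : ℝ) < ((N + 1 : ℕ) : ℝ) := by positivity
      refine ⟨g1, fun k => ?_, ?_, ?_⟩
      · refine (prod_le_ofReal_exp Finset.univ (x := fun i : Fin (N + 1) =>
          sectionMass μ φ k (ω i)) fun i _ => h6 k i).trans (ENNReal.ofReal_le_ofReal ?_)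
        rw [Real.exp_le_exp, ← inv_mul_le_iff₀ hN]
        exact (g2 k).le
      · refine (ENNReal.ofReal_le_ofReal ?_).trans (ofReal_exp_le_prod _ fun i _ => h4 i)
        rw [Real.exp_le_exp, ← le_inv_mul_iff₀ hN]
        exact g4.le
      · refine (prod_le_ofReal_exp Finset.univ (x := fun i : Fin (N + 1) =>
          φ (ω i)) fun i _ => h5 i).trans (ENNReal.ofReal_le_ofReal ?_)
        rw [Real.exp_le_exp, ← inv_mul_le_iff₀ hN]
        exact g3.le)
  filter_upwards [hev] with N hN
  set A := typicalSet μ φ U H h δ (N + 1) with hA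
  have hAm : MeasurableSet A := measurableSet_typicalSet μ hφ hU H h δ (N + 1)
  rw [hν, pi_withDensity hφ, withDensity_apply _ hAm] at hN
  have h7 : 2⁻¹ ≤ ENNReal.ofReal (Real.exp (((N + 1 : ℕ) : ℝ) * (h + δ))) *
      (Measure.pi fun _ : Fin (N + 1) => Measure.pi μ) A := by
    refine hN.trans ((setLIntegral_mono measurable_const fun y hy => hy.2.2.2).trans ?_)
    rw [setLIntegral_const]
  have h8 := ENNReal.toReal_mono (ENNReal.mul_ne_top ENNReal.ofReal_ne_top
    (measure_ne_top _ _)) h7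
  rw [ENNReal.toReal_mul, ENNReal.toReal_ofReal (Real.exp_pos _).le, ENNReal.toReal_inv,
    ENNReal.toReal_ofNat] at h8
  rw [Real.exp_neg, measureReal_def, div_le_iff₀ two_pos, inv_le_iff_one_le_mul₀ (Real.exp_pos _)]
  linarith

end Typical

end

/-! ### Growth of the tree, Borel-Cantelli and mixtures with the reference measure. -/

section

section Branching

variable {n : ℕ} {Θ : ℝ} {γ : Fin n → ℝ}

lemma two_rpow_eq_exp (Θ g : ℝ) (N : ℕ) :
    (2 : ℝ) ^ (g * Θ * N) = Real.exp (N * (Θ * Real.log 2 * g)) := by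
  rw [Real.rpow_def_of_pos two_pos]; ring_nf

lemma branching_le_exp (N : ℕ) (k : Fin n) :
    (branching Θ γ N k : ℝ) ≤ Real.exp (N * (Θ * Real.log 2 * γ k)) := by
  rw [← two_rpow_eq_exp]
  exact Nat.floor_le (Real.rpow_nonneg two_pos.le _)

/-- The integer part of a real number at least 1 is at least half of it. -/
lemma exp_div_two_le_branching (hΘ : 0 < Θ) (hγ : ∀ k, 0 < γ k) (N : ℕ) (k : Fin n) :
    Real.exp (N * (Θ * Real.log 2 * γ k)) / 2 ≤ branching Θ γ N k := by
  rw [← two_rpow_eq_exp]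
  have h1 : (1 : ℝ) ≤ (2 : ℝ) ^ (γ k * Θ * N) :=
    Real.one_le_rpow one_le_two (mul_nonneg (mul_pos (hγ k) hΘ).le (Nat.cast_nonneg N))
  have h2 := Nat.lt_floor_add_one ((2 : ℝ) ^ (γ k * Θ * N))
  have h3 : (1 : ℝ) ≤ (⌊(2 : ℝ) ^ (γ k * Θ * N)⌋₊ : ℝ) := by
    exact_mod_cast (Nat.one_le_floor_iff _).2 h1
  rw [branching]
  linarith

lemma branching_pos (hΘ : 0 < Θ) (hγ : ∀ k, 0 < γ k) (N : ℕ) (k : Fin n) :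
    0 < branching Θ γ N k := by
  have := (half_pos (Real.exp_pos _)).trans_le (exp_div_two_le_branching hΘ hγ N k)
  exact_mod_cast this

lemma prod_branching_le_exp (N : ℕ) (s : Finset (Fin n)) :
    ∏ j ∈ s, (branching Θ γ N j : ℝ) ≤ Real.exp (N * (Θ * Real.log 2 * ∑ j ∈ s, γ j)) := by
  rw [Finset.mul_sum, Finset.mul_sum, Real.exp_sum]
  exact Finset.prod_le_prod (fun j _ => Nat.cast_nonneg _) fun j _ => branching_le_exp N j

lemma exp_le_prod_branching (hΘ : 0 < Θ) (hγ : ∀ k, 0 < γ k) (N : ℕ) (s : Finset (Fin n)) :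
    Real.exp (N * (Θ * Real.log 2 * ∑ j ∈ s, γ j)) / 2 ^ n ≤
      ∏ j ∈ s, (branching Θ γ N j : ℝ) := by
  have hs : s.card ≤ n := by simpa using s.card_le_univ
  calc Real.exp (N * (Θ * Real.log 2 * ∑ j ∈ s, γ j)) / 2 ^ n
      ≤ Real.exp (N * (Θ * Real.log 2 * ∑ j ∈ s, γ j)) / 2 ^ s.card := by
        gcongr
        norm_num
    _ = ∏ j ∈ s, (Real.exp (N * (Θ * Real.log 2 * γ j)) / 2) := by
        rw [Finset.prod_div_distrib, Finset.prod_const, Finset.mul_sum, Finset.mul_sum,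
          Real.exp_sum]
    _ ≤ _ := Finset.prod_le_prod (fun j _ => (half_pos (Real.exp_pos _)).le)
        fun j _ => exp_div_two_le_branching hΘ hγ N j

end Branching

section BorelCantelli

variable {n : ℕ} {Θ : ℝ} {γ : Fin n → ℝ} {μ : Fin n → Measure ℝ}
  {Ω : Type*} [MeasurableSpace Ω] {P : Measure Ω}
  [IsProbabilityMeasure P] {X : (N : ℕ) → Site Θ γ N → Ω → ℝ}

lemma measure_array_le (hX_indep : ∀ N, iIndepFun (X N) P)
    (hX_law : ∀ N s, HasLaw (X N s) (μ s.1) P) (N : ℕ) (B : Set (Site Θ γ N → ℝ)) :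
    P {ω | (fun s => X N s ω) ∈ B} ≤ siteMeasure Θ γ N μ B := by
  have hm : ∀ s, AEMeasurable (X N s) P := fun s => (hX_law N s).aemeasurable
  have h := (iIndepFun_iff_map_fun_eq_pi_map hm).1 (hX_indep N)
  have h' : P.map (fun ω s => X N s ω) = siteMeasure Θ γ N μ := by
    rw [h, siteMeasure]
    congr 1
    funext s
    exact (hX_law N s).map_eq
  rw [← h']
  exact Measure.le_map_apply (aemeasurable_pi_lambda _ hm) B

/-- Only the law at each fixed `N` enters, through the summable half of Borel-Cantelli, so no
relation between different `N` is needed. The sets `B N` need not be measurable. -/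
lemma ae_eventually_array_notMem (hX_indep : ∀ N, iIndepFun (X N) P)
    (hX_law : ∀ N s, HasLaw (X N s) (μ s.1) P) {B : (N : ℕ) → Set (Site Θ γ (N + 1) → ℝ)}
    {C c : ℝ} (hc : 0 < c)
    (hB : ∀ᶠ N : ℕ in atTop, siteMeasure Θ γ (N + 1) μ (B N) ≤
      ENNReal.ofReal (C * Real.exp (-(c * (N + 1 : ℕ))))) :
    ∀ᵐ ω ∂P, ∀ᶠ N : ℕ in atTop, (fun s => X (N + 1) s ω) ∉ B N := by
  obtain ⟨N₀, hN₀⟩ := eventually_atTop.1 hB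
  set s : ℕ → Set Ω := fun N => {ω | N₀ ≤ N ∧ (fun s => X (N + 1) s ω) ∈ B N} with hs
  have hle : ∀ N, P (s N) ≤ ENNReal.ofReal (C * Real.exp (-(c * (N + 1 : ℕ)))) := by
    intro N
    by_cases hN : N₀ ≤ N
    · refine (measure_mono fun ω hω => hω.2).trans
        ((measure_array_le hX_indep hX_law (N + 1) (B N)).trans (hN₀ N hN))
    · simp [hs, hN]
  have hsum : Summable fun N : ℕ => C * Real.exp (-(c * (N + 1 : ℕ))) := by
    have h1 : Summable fun N : ℕ => Real.exp (-c) ^ N :=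
      summable_geometric_of_lt_one (Real.exp_pos _).le (by
        rw [Real.exp_lt_one_iff]; linarith)
    refine (((summable_nat_add_iff 1).2 h1).mul_left C).congr fun N => ?_
    rw [← Real.exp_nat_mul]
    ring_nf
  have hfin : ∑' N, P (s N) ≠ ∞ :=
    ne_top_of_le_ne_top hsum.tsum_ofReal_ne_top (ENNReal.tsum_le_tsum hle)
  filter_upwards [ae_eventually_notMem hfin] with ω hω
  filter_upwards [hω, eventually_ge_atTop N₀] with N h1 h2 h3
  exact h1 ⟨h2, h3⟩

end BorelCantelli

section Mixture

variable {E : Type*} [MeasurableSpace E]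

/-- The mixture `(1 - t) ν + t m`. -/
noncomputable def mixture (ν m : Measure E) (t : ℝ) : Measure E :=
  ENNReal.ofReal (1 - t) • ν + ENNReal.ofReal t • m

variable {ν m : Measure E} {t : ℝ}

lemma isProbabilityMeasure_mixture [IsProbabilityMeasure ν] [IsProbabilityMeasure m]
    (h0 : 0 ≤ t) (h1 : t ≤ 1) : IsProbabilityMeasure (mixture ν m t) := ⟨by
  simp only [mixture, Measure.add_apply, Measure.smul_apply, measure_univ, smul_eq_mul, mul_one]
  rw [← ENNReal.ofReal_add (by linarith) h0]
  simp⟩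

/-- The mixture `(1 - t) ν + t m` as a probability measure. -/
noncomputable def probMixture (ν : ProbabilityMeasure E) (m : Measure E) [IsProbabilityMeasure m]
    (t : ℝ) (h0 : 0 ≤ t) (h1 : t ≤ 1) : ProbabilityMeasure E :=
  ⟨mixture (ν : Measure E) m t, isProbabilityMeasure_mixture h0 h1⟩

/-- The mixture has density `(1 - t) dν/dm + t`, and `klFun` is convex with `klFun 1 = 0`. With `t <
1` the right side stays infinite when `ν` is not absolutely continuous. -/
lemma klDiv_mixture_le [IsProbabilityMeasure ν] [IsProbabilityMeasure m]
    (h0 : 0 ≤ t) (h1 : t < 1) : klDiv (mixture ν m t) m ≤ ENNReal.ofReal (1 - t) * klDiv ν m := by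
  have hpos : 0 < ENNReal.ofReal (1 - t) := by simpa using h1
  by_cases hac : ν ≪ m
  swap
  · rw [klDiv_of_not_ac hac, ENNReal.mul_top hpos.ne']; exact le_top
  have := isProbabilityMeasure_mixture (ν := ν) (m := m) h0 h1.le
  have hmac : mixture ν m t ≪ m :=
    Measure.AbsolutelyContinuous.add_left (hac.smul_left _)
      (Measure.AbsolutelyContinuous.rfl.smul_left _)
  rw [klDiv_eq_lintegral_klFun_of_ac hmac, klDiv_eq_lintegral_klFun_of_ac hac,
    ← lintegral_const_mul _ (by fun_prop)]
  have hrn : (mixture ν m t).rnDeriv m =ᵐ[m]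
      fun x => ENNReal.ofReal (1 - t) * ν.rnDeriv m x + ENNReal.ofReal t := by
    have f1 : IsFiniteMeasure (ENNReal.ofReal (1 - t) • ν) :=
      ν.smul_finite ENNReal.ofReal_ne_top
    have f2 : IsFiniteMeasure (ENNReal.ofReal t • m) := m.smul_finite ENNReal.ofReal_ne_top
    filter_upwards [Measure.rnDeriv_add (ENNReal.ofReal (1 - t) • ν) (ENNReal.ofReal t • m) m,
      Measure.rnDeriv_smul_left_of_ne_top ν m (ENNReal.ofReal_ne_top (r := 1 - t)),
      Measure.rnDeriv_smul_left_of_ne_top m m (ENNReal.ofReal_ne_top (r := t)),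
      Measure.rnDeriv_self m] with x e1 e2 e3 e4
    rw [mixture, e1, Pi.add_apply, e2, e3, Pi.smul_apply, Pi.smul_apply, e4]
    simp
  refine lintegral_mono_ae ?_
  filter_upwards [hrn, Measure.rnDeriv_lt_top ν m] with x hx hfin
  rw [hx, ← ENNReal.ofReal_mul (by linarith)]
  refine ENNReal.ofReal_le_ofReal ?_
  rw [ENNReal.toReal_add (ENNReal.mul_ne_top ENNReal.ofReal_ne_top hfin.ne)
    ENNReal.ofReal_ne_top, ENNReal.toReal_mul, ENNReal.toReal_ofReal (by linarith),
    ENNReal.toReal_ofReal h0]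
  have hconv := convexOn_klFun.2 (show (ν.rnDeriv m x).toReal ∈ Set.Ici 0 from
    ENNReal.toReal_nonneg) (show (1 : ℝ) ∈ Set.Ici 0 from Set.mem_Ici.2 zero_le_one)
    (show 0 ≤ 1 - t by linarith) h0 (by ring)
  simpa [klFun_one] using hconv

lemma marginal_mixture {n : ℕ} {ν m : Measure (Fin n → ℝ)} (k : Fin n) :
    marginal k (mixture ν m t) = mixture (marginal k ν) (marginal k m) t := by
  simp only [marginal, mixture]
  rw [Measure.map_add _ _ (measurable_restrictLE k), Measure.map_smul, Measure.map_smul]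

lemma tendsto_probMixture [TopologicalSpace E] [OpensMeasurableSpace E] {ν : ProbabilityMeasure E}
    [IsProbabilityMeasure m] {t : ℕ → ℝ} (ht : Tendsto t atTop (𝓝 0)) (h0 : ∀ j, 0 ≤ t j)
    (h1 : ∀ j, t j ≤ 1) :
    Tendsto (fun j => probMixture ν m (t j) (h0 j) (h1 j)) atTop (𝓝 ν) := by
  rw [ProbabilityMeasure.tendsto_iff_forall_integral_tendsto]
  intro f
  have hval : ∀ j, ∫ x, f x ∂(mixture (ν : Measure E) m (t j)) =
      (1 - t j) * ∫ x, f x ∂(ν : Measure E) + t j * ∫ x, f x ∂m := fun j => by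
    rw [mixture, integral_add_measure ((f.integrable _).smul_measure ENNReal.ofReal_ne_top)
      ((f.integrable _).smul_measure ENNReal.ofReal_ne_top), integral_smul_measure,
      integral_smul_measure, ENNReal.toReal_ofReal (by linarith [h1 j]),
      ENNReal.toReal_ofReal (h0 j), smul_eq_mul, smul_eq_mul]
  simp only [probMixture, ProbabilityMeasure.coe_mk, hval]
  have := ((ht.const_sub 1).mul_const (∫ x, f x ∂(ν : Measure E))).add
    (ht.mul_const (∫ x, f x ∂m))
  simpa using this

end Mixture

end

/-! ### Lower bound for the free energy. -/

section

section LowerBound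

variable {n : ℕ} {Θ : ℝ} {γ : Fin n → ℝ}

lemma le_freeEnergy_of_le_hitCount {N : ℕ} [NeZero N] {Φ : ProbabilityMeasure (Fin n → ℝ) → ℝ}
    {A : Set (Fin N → Fin n → ℝ)} {b K : ℝ} (hA : ∀ y ∈ A, b ≤ Φ (empirical y)) (hK : 0 < K)
    {x : Site Θ γ N → ℝ} (hx : K ≤ hitCount A x) :
    b + Real.log K / N ≤ freeEnergy Φ x := by
  have hN : (0 : ℝ) < N := by exact_mod_cast NeZero.pos N
  have h1 : K * Real.exp (N * b) ≤
      ∑ α : Config Θ γ N, Real.exp ((N : ℝ) * Φ (empirical (spinVector x α))) := by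
    refine (mul_le_mul_of_nonneg_right hx (Real.exp_pos _).le).trans ?_
    rw [hitCount, Finset.sum_mul]
    refine Finset.sum_le_sum fun α _ => ?_
    by_cases h : spinVector x α ∈ A
    · rw [Set.indicator_of_mem h, one_mul, Real.exp_le_exp]
      exact mul_le_mul_of_nonneg_left (hA _ h) hN.le
    · rw [Set.indicator_of_notMem h, zero_mul]
      exact (Real.exp_pos _).le
  have h2 := Real.log_le_log (mul_pos hK (Real.exp_pos _)) h1
  rw [Real.log_mul hK.ne' (Real.exp_pos _).ne', Real.log_exp] at h2
  rw [freeEnergy, one_div, le_inv_mul_iff₀ hN]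
  calc (N : ℝ) * (b + Real.log K / N) = Real.log K + N * b := by field_simp; ring
    _ ≤ _ := h2

lemma exists_last (hγ_sum : ∑ k, γ k = 1) : ∃ k₀ : Fin n, ∀ j, j ≤ k₀ := by
  cases n with
  | zero => simp at hγ_sum
  | succ n => exact ⟨Fin.last n, Fin.le_last⟩

/-- Data processing along `extendZero`, which undoes the marginal map at the last level. It makes
the last constraint control the full entropy, in particular its finiteness. -/
lemma klDiv_le_klDiv_marginal {k₀ : Fin n} (hk₀ : ∀ j, j ≤ k₀) (ν m : Measure (Fin n → ℝ))
    [IsProbabilityMeasure ν] [IsProbabilityMeasure m] :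
    klDiv ν m ≤ klDiv (marginal k₀ ν) (marginal k₀ m) := by
  have hmap : ∀ ρ : Measure (Fin n → ℝ), (marginal k₀ ρ).map (extendZero k₀) = ρ := fun ρ => by
    rw [marginal, Measure.map_map (measurable_extendZero k₀) (measurable_restrictLE k₀)]
    have : (extendZero k₀ ∘ fun (y : Fin n → ℝ) (j : {j : Fin n // j ≤ k₀}) => y j.1) = id := by
      funext y j
      simp [extendZero, hk₀ j]
    rw [this, Measure.map_id]
  have h := klDiv_map_le (marginal k₀ ν) (marginal k₀ m) (measurable_extendZero k₀)
  rwa [hmap, hmap] at h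

variable {μ : Fin n → Measure ℝ} [∀ k, IsProbabilityMeasure (μ k)] {Ω : Type*} [MeasurableSpace Ω]
  {P : Measure Ω} [IsProbabilityMeasure P] {X : (N : ℕ) → Site Θ γ N → Ω → ℝ}

/-- Along arrays typical for a density `φ` whose marginal entropies `H k` stay below the growth
rates of the numbers of segments, the number of hits is eventually at least half its mean. -/
lemma siteMeasure_hitCount_typicalSet_le (hΘ : 0 < Θ) (hγ : ∀ k, 0 < γ k)
    {φ : (Fin n → ℝ) → ℝ≥0∞} (hφ : Measurable φ) {U : Set (ProbabilityMeasure (Fin n → ℝ))}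
    (hU : IsOpen U) {H : Fin n → ℝ} {h δ : ℝ} {N : ℕ} [NeZero N]
    (hH : ∀ k, H k + 4 * δ ≤ Θ * Real.log 2 * ∑ j ∈ Finset.Iic k, γ j)
    (hp : Real.exp (-((N : ℝ) * (h + δ))) / 2 ≤ (Measure.pi fun _ : Fin N => Measure.pi μ).real
      (typicalSet μ φ U H h δ N)) :
    siteMeasure Θ γ N μ {x | hitCount (typicalSet μ φ U H h δ N) x <
      Fintype.card (Config Θ γ N) * (Measure.pi fun _ : Fin N => Measure.pi μ).real
        (typicalSet μ φ U H h δ N) / 2} ≤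
      ENNReal.ofReal (8 * 2 ^ n * n * Real.exp (-(δ * N))) := by
  set A := typicalSet μ φ U H h δ N with hA
  set p := (Measure.pi fun _ : Fin N => Measure.pi μ).real A with hpdef
  have hp0 : 0 < p := (half_pos (Real.exp_pos _)).trans_le hp
  refine (siteMeasure_hitCount_lt_le μ hφ (measurableSet_typicalSet μ hφ hU H h δ N)
    (c := Real.exp (N * (h - δ))) (d := fun k => Real.exp (N * (H k + δ))) (Real.exp_pos _)
    (fun k => (Real.exp_pos _).le) (fun y hy => hy.2.2.1) (fun k y hy => hy.2.1 k)
    (branching_pos hΘ hγ N) hp0).trans (ENNReal.ofReal_le_ofReal ?_)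
  -- The typical-set tolerances cost `3 δ` in total: one from the section product and two from `c *
  -- p`. The gap `4 δ` in `hH` therefore leaves the rate `-δ`.
  have hterm : ∀ k, Real.exp (N * (H k + δ)) / (Real.exp (N * (h - δ)) * p *
      ∏ j ∈ Finset.Iic k, (branching Θ γ N j : ℝ)) ≤ 2 * 2 ^ n * Real.exp (-(δ * N)) := by
    intro k
    have hprod := exp_le_prod_branching hΘ hγ N (Finset.Iic k)
    set b := Θ * Real.log 2 * ∑ j ∈ Finset.Iic k, γ j with hb
    have hlow : Real.exp (N * (h - δ)) * (Real.exp (-((N : ℝ) * (h + δ))) / 2) *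
        (Real.exp (N * b) / 2 ^ n) ≤ Real.exp (N * (h - δ)) * p *
          ∏ j ∈ Finset.Iic k, (branching Θ γ N j : ℝ) := by gcongr
    have hlow0 : 0 < Real.exp (N * (h - δ)) * (Real.exp (-((N : ℝ) * (h + δ))) / 2) *
        (Real.exp (N * b) / 2 ^ n) := by positivity
    rw [div_le_iff₀ (hlow0.trans_le hlow)]
    refine le_trans ?_ (mul_le_mul_of_nonneg_left hlow (by positivity))
    have : 2 * 2 ^ n * Real.exp (-(δ * N)) * (Real.exp (N * (h - δ)) *
        (Real.exp (-((N : ℝ) * (h + δ))) / 2) * (Real.exp (N * b) / 2 ^ n)) =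
        Real.exp (N * (b - 3 * δ)) := by
      have e : Real.exp (N * (b - 3 * δ)) = Real.exp (-(δ * N)) * (Real.exp (N * (h - δ)) *
        Real.exp (-((N : ℝ) * (h + δ))) * Real.exp (N * b)) := by
        simp only [← Real.exp_add]
        ring_nf
      rw [e]
      field_simp
    rw [this, Real.exp_le_exp]
    exact mul_le_mul_of_nonneg_left (by linarith [hH k]) (Nat.cast_nonneg N)
  calc _ ≤ 4 * ∑ _k : Fin n, 2 * 2 ^ n * Real.exp (-(δ * N)) := by
        gcongr with k
        exact hterm k
    _ = _ := by
        rw [Finset.sum_const, Finset.card_univ, Fintype.card_fin, nsmul_eq_mul]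
        ring

lemma ae_eventually_le_freeEnergy_of_lt (hΘ : 0 < Θ) (hγ : ∀ k, 0 < γ k) (hγ_sum : ∑ k, γ k = 1)
    (hX_indep : ∀ N, iIndepFun (X N) P) (hX_law : ∀ N s, HasLaw (X N s) (μ s.1) P)
    {Φ : ProbabilityMeasure (Fin n → ℝ) → ℝ} (hΦ : Continuous Φ)
    (ν : ProbabilityMeasure (Fin n → ℝ))
    (hν : ∀ k, klDiv (marginal k (ν : Measure (Fin n → ℝ))) (marginal k (Measure.pi μ)) <
      ENNReal.ofReal (Θ * Real.log 2 * ∑ j ∈ Finset.Iic k, γ j)) {ε : ℝ} (hε : 0 < ε) :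
    ∀ᵐ ω ∂P, ∀ᶠ N : ℕ in atTop,
      Φ ν - (klDiv (ν : Measure (Fin n → ℝ)) (Measure.pi μ)).toReal + Θ * Real.log 2 - ε ≤
        freeEnergy (N := N + 1) Φ (fun s => X (N + 1) s ω) := by
  obtain ⟨k₀, hk₀⟩ := exists_last hγ_sum
  have hfin : klDiv (ν : Measure (Fin n → ℝ)) (Measure.pi μ) ≠ ∞ :=
    ((klDiv_le_klDiv_marginal hk₀ _ _).trans_lt ((hν k₀).trans ENNReal.ofReal_lt_top)).ne
  obtain ⟨hac, -⟩ := klDiv_ne_top_iff.1 hfin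
  set φ := (ν : Measure (Fin n → ℝ)).rnDeriv (Measure.pi μ) with hφdef
  have hφ : Measurable φ := Measure.measurable_rnDeriv _ _
  have hνφ : (ν : Measure (Fin n → ℝ)) = (Measure.pi μ).withDensity φ :=
    (Measure.withDensity_rnDeriv_eq _ _ hac).symm
  have hpr : IsProbabilityMeasure ((Measure.pi μ).withDensity φ) := hνφ ▸ inferInstance
  have hmarg := fun k => klDiv_marginal μ hφ (k := k)
    (hνφ ▸ ((hν k).trans ENNReal.ofReal_lt_top).ne)
  rw [← hνφ] at hmarg
  set H : Fin n → ℝ := fun k => ∫ y, Real.log (sectionMass μ φ k y).toReal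
    ∂(ν : Measure (Fin n → ℝ)) with hH
  set h : ℝ := ∫ y, Real.log (φ y).toReal ∂(ν : Measure (Fin n → ℝ)) with hh
  have hsec := sectionMass_eq_self μ (φ := φ) hk₀
  have hi : Integrable (fun y => Real.log (φ y).toReal) (ν : Measure (Fin n → ℝ)) := by
    have := (hmarg k₀).1
    rwa [hsec] at this
  have hhle : h ≤ (klDiv (ν : Measure (Fin n → ℝ)) (Measure.pi μ)).toReal := by
    have h1 := (hmarg k₀).2
    rw [hsec] at h1
    rw [hh, ← h1]
    exact ENNReal.toReal_mono hfin (klDiv_map_le _ _ (measurable_restrictLE k₀))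
  have hgap : ∀ k, H k < Θ * Real.log 2 * ∑ j ∈ Finset.Iic k, γ j := fun k => by
    rw [hH]
    simp only
    rw [← (hmarg k).2]
    exact (ENNReal.lt_ofReal_iff_toReal_lt ((hν k).trans ENNReal.ofReal_lt_top).ne).1 (hν k)
  -- The budget `ε` is spent in quarters: one on the oscillation of `Φ` over `U`, one on `δ`, one on
  -- the constant factor in the count.
  obtain ⟨δ, ⟨hδgap, hδε⟩, hδ⟩ : ∃ δ : ℝ, ((∀ k, H k + 4 * δ ≤
      Θ * Real.log 2 * ∑ j ∈ Finset.Iic k, γ j) ∧ δ ≤ ε / 4) ∧ 0 < δ := by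
    have h1 : ∀ᶠ δ : ℝ in 𝓝[>] 0, ∀ k, H k + 4 * δ ≤
        Θ * Real.log 2 * ∑ j ∈ Finset.Iic k, γ j := by
      refine eventually_all.2 fun k => ?_
      have ht : Tendsto (fun δ : ℝ => H k + 4 * δ) (𝓝[>] 0) (𝓝 (H k + 4 * 0)) :=
        ((continuous_const.add (continuous_const.mul continuous_id)).tendsto 0).mono_left
          nhdsWithin_le_nhds
      rw [mul_zero, add_zero] at ht
      filter_upwards [ht.eventually_lt_const (hgap k)] with δ hδ using hδ.le
    have h2 : ∀ᶠ δ : ℝ in 𝓝[>] 0, δ ≤ ε / 4 :=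
      nhdsWithin_le_nhds (Iic_mem_nhds (by positivity))
    exact ((h1.and h2).and self_mem_nhdsWithin).exists
  set U : Set (ProbabilityMeasure (Fin n → ℝ)) := {ρ | Φ ν - ε / 4 < Φ ρ} with hUdef
  have hU : IsOpen U := isOpen_lt continuous_const hΦ
  have htyp := eventually_typicalSet μ hφ ν hνφ hi (fun k => (hmarg k).1) hU
    (show Φ ν - ε / 4 < Φ ν by linarith) hδ
  have hae := ae_eventually_array_notMem hX_indep hX_law (B := fun N => {x |
      hitCount (typicalSet μ φ U H h δ (N + 1)) x < Fintype.card (Config Θ γ (N + 1)) *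
        (Measure.pi fun _ : Fin (N + 1) => Measure.pi μ).real
          (typicalSet μ φ U H h δ (N + 1)) / 2}) (C := 8 * 2 ^ n * n) hδ (by
    filter_upwards [htyp] with N hN
    exact siteMeasure_hitCount_typicalSet_le hΘ hγ hφ hU hδgap hN)
  have hsmall : ∀ᶠ N : ℕ in atTop, Real.log (4 * 2 ^ n) / ((N + 1 : ℕ) : ℝ) < ε / 4 := by
    have := (tendsto_const_div_atTop_nhds_zero_nat (Real.log (4 * 2 ^ n)))
    exact ((tendsto_add_atTop_iff_nat 1).2 this).eventually_lt_const (by positivity)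
  filter_upwards [hae] with ω hω
  filter_upwards [hω, htyp, hsmall] with N h1 h2 h3
  simp only [not_lt] at h1
  have hN : (0 : ℝ) < ((N + 1 : ℕ) : ℝ) := by positivity
  have hcard : Real.exp (((N + 1 : ℕ) : ℝ) * (Θ * Real.log 2)) / 2 ^ n ≤
      (Fintype.card (Config Θ γ (N + 1)) : ℝ) := by
    have := exp_le_prod_branching hΘ hγ (N + 1) Finset.univ
    rw [hγ_sum, mul_one] at this
    rw [card_config]
    exact_mod_cast this
  -- A lower bound for half the mean count: `2 ^ n` comes from the integer parts, one factor 2 from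
  -- the typical-set probability and one from halving the mean.
  set K : ℝ := Real.exp (((N + 1 : ℕ) : ℝ) * (Θ * Real.log 2 - h - δ)) / (4 * 2 ^ n) with hK
  have hKle : K ≤ hitCount (typicalSet μ φ U H h δ (N + 1)) fun s => X (N + 1) s ω := by
    refine le_trans ?_ h1
    calc K = Real.exp (((N + 1 : ℕ) : ℝ) * (Θ * Real.log 2)) / 2 ^ n *
          (Real.exp (-(((N + 1 : ℕ) : ℝ) * (h + δ))) / 2) / 2 := by
          have e : Real.exp (((N + 1 : ℕ) : ℝ) * (Θ * Real.log 2 - h - δ)) =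
              Real.exp (((N + 1 : ℕ) : ℝ) * (Θ * Real.log 2)) *
                Real.exp (-(((N + 1 : ℕ) : ℝ) * (h + δ))) := by
            rw [← Real.exp_add]; ring_nf
          rw [hK, e]
          field_simp
          norm_num
      _ ≤ _ := by gcongr
  have hfree := le_freeEnergy_of_le_hitCount (Φ := Φ) (b := Φ ν - ε / 4)
    (fun y hy => (show Φ ν - ε / 4 < Φ (empirical y) from hy.1).le) (by positivity) hKle
  refine le_trans ?_ hfree
  have hlog : Real.log K / ((N + 1 : ℕ) : ℝ) = (Θ * Real.log 2 - h - δ) -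
      Real.log (4 * 2 ^ n) / ((N + 1 : ℕ) : ℝ) := by
    rw [hK, Real.log_div (Real.exp_pos _).ne' (by positivity), Real.log_exp, sub_div,
      mul_div_cancel_left₀ _ hN.ne']
  rw [hlog]
  linarith

/-- Mixing in a little of `Measure.pi μ` makes all constraints strict, since their bounds are
positive. The entropy does not increase, and `Φ` changes little by continuity. -/
lemma ae_eventually_le_freeEnergy (hΘ : 0 < Θ) (hγ : ∀ k, 0 < γ k) (hγ_sum : ∑ k, γ k = 1)
    (hX_indep : ∀ N, iIndepFun (X N) P) (hX_law : ∀ N s, HasLaw (X N s) (μ s.1) P)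
    {Φ : ProbabilityMeasure (Fin n → ℝ) → ℝ} (hΦ : Continuous Φ)
    {ν : ProbabilityMeasure (Fin n → ℝ)} (hν : ν ∈ entropySet Θ γ (Measure.pi μ))
    {ε : ℝ} (hε : 0 < ε) :
    ∀ᵐ ω ∂P, ∀ᶠ N : ℕ in atTop,
      Φ ν - (klDiv (ν : Measure (Fin n → ℝ)) (Measure.pi μ)).toReal + Θ * Real.log 2 - ε ≤
        freeEnergy (N := N + 1) Φ (fun s => X (N + 1) s ω) := by
  obtain ⟨k₀, hk₀⟩ := exists_last hγ_sum
  have hfin : klDiv (ν : Measure (Fin n → ℝ)) (Measure.pi μ) ≠ ∞ :=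
    ((klDiv_le_klDiv_marginal hk₀ _ _).trans_lt ((hν k₀).trans_lt ENNReal.ofReal_lt_top)).ne
  -- The extra `+ 1` keeps `t 0` strictly below 1.
  set t : ℕ → ℝ := fun j => 1 / ((j : ℝ) + 1 + 1) with ht
  have ht0 : ∀ j, 0 < t j := fun j => by rw [ht]; positivity
  have ht1 : ∀ j, t j < 1 := fun j => by
    rw [ht]; simp only
    rw [div_lt_one (by positivity)]
    linarith [(Nat.cast_nonneg j : (0 : ℝ) ≤ j)]
  have htlim : Tendsto t atTop (𝓝 0) := by
    have := (tendsto_add_atTop_iff_nat 1).2 (tendsto_one_div_add_atTop_nhds_zero_nat (𝕜 := ℝ))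
    simpa [ht] using this
  have hlim := hΦ.continuousAt.tendsto.comp (tendsto_probMixture (ν := ν) (m := Measure.pi μ)
    htlim (fun j => (ht0 j).le) fun j => (ht1 j).le)
  obtain ⟨j, hj⟩ := (hlim.eventually_const_lt (show Φ ν - ε / 2 < Φ ν by linarith)).exists
  set ρ := probMixture ν (Measure.pi μ) (t j) (ht0 j).le (ht1 j).le with hρ
  have hcoe : (ρ : Measure (Fin n → ℝ)) = mixture (ν : Measure (Fin n → ℝ)) (Measure.pi μ) (t j) :=
    rfl
  have hlt1 : ENNReal.ofReal (1 - t j) < 1 := by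
    rw [ENNReal.ofReal_lt_one]; linarith [ht0 j]
  have hstrict : ∀ k, klDiv (marginal k (ρ : Measure (Fin n → ℝ))) (marginal k (Measure.pi μ)) <
      ENNReal.ofReal (Θ * Real.log 2 * ∑ j ∈ Finset.Iic k, γ j) := fun k => by
    have hpos : 0 < Θ * Real.log 2 * ∑ j ∈ Finset.Iic k, γ j :=
      mul_pos (mul_pos hΘ (Real.log_pos one_lt_two))
        (Finset.sum_pos (fun j _ => hγ j) ⟨k, Finset.mem_Iic.2 le_rfl⟩)
    rw [hcoe, marginal_mixture]
    calc _ ≤ ENNReal.ofReal (1 - t j) *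
          klDiv (marginal k (ν : Measure (Fin n → ℝ))) (marginal k (Measure.pi μ)) :=
          klDiv_mixture_le (ht0 j).le (ht1 j)
      _ ≤ ENNReal.ofReal (1 - t j) *
          ENNReal.ofReal (Θ * Real.log 2 * ∑ j ∈ Finset.Iic k, γ j) := by gcongr; exact hν k
      _ < 1 * ENNReal.ofReal (Θ * Real.log 2 * ∑ j ∈ Finset.Iic k, γ j) :=
          ENNReal.mul_lt_mul_left (by simpa using hpos) ENNReal.ofReal_ne_top hlt1
      _ = _ := one_mul _
  have hkl : (klDiv (ρ : Measure (Fin n → ℝ)) (Measure.pi μ)).toReal ≤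
      (klDiv (ν : Measure (Fin n → ℝ)) (Measure.pi μ)).toReal := by
    refine ENNReal.toReal_mono hfin ((klDiv_mixture_le (ht0 j).le (ht1 j)).trans ?_)
    exact mul_le_of_le_one_left' hlt1.le
  filter_upwards [ae_eventually_le_freeEnergy_of_lt hΘ hγ hγ_sum hX_indep hX_law hΦ ρ hstrict
    (half_pos hε)] with ω hω
  filter_upwards [hω] with N hN
  refine le_trans ?_ hN
  simp only [Function.comp] at hj
  linarith

end LowerBound

end

/-! ### Upper bound for the free energy. -/

section

section UpperBound

variable {n : ℕ} {Θ : ℝ} {γ : Fin n → ℝ}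

/-- The part of the partition function carried by the configurations whose empirical measure is
in `S`. -/
noncomputable def partialSum {N : ℕ} [NeZero N] (Φ : ProbabilityMeasure (Fin n → ℝ) → ℝ)
    (S : Set (ProbabilityMeasure (Fin n → ℝ))) (x : Site Θ γ N → ℝ) : ℝ :=
  ∑ α : Config Θ γ N, S.indicator (fun ρ => Real.exp ((N : ℝ) * Φ ρ)) (empirical (spinVector x α))

lemma card_config_le_exp (hγ_sum : ∑ k, γ k = 1) (N : ℕ) :
    (Fintype.card (Config Θ γ N) : ℝ) ≤ Real.exp (N * (Θ * Real.log 2)) := by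
  have := prod_branching_le_exp (Θ := Θ) (γ := γ) N Finset.univ
  rw [hγ_sum, mul_one] at this
  rw [card_config]
  exact_mod_cast this

lemma freeEnergy_le (hΘ : 0 < Θ) (hγ : ∀ k, 0 < γ k) {N : ℕ} [NeZero N]
    {Φ : ProbabilityMeasure (Fin n → ℝ) → ℝ} {x : Site Θ γ N → ℝ} {C b : ℝ} (hC : 0 < C)
    (h : ∑ α : Config Θ γ N, Real.exp ((N : ℝ) * Φ (empirical (spinVector x α))) ≤
      C * Real.exp (N * b)) :
    freeEnergy Φ x ≤ b + Real.log C / N := by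
  have hN : (0 : ℝ) < N := by exact_mod_cast NeZero.pos N
  have hne : Nonempty (Config Θ γ N) := ⟨fun k => ⟨0, branching_pos hΘ hγ N k⟩⟩
  have hpos : 0 < ∑ α : Config Θ γ N, Real.exp ((N : ℝ) * Φ (empirical (spinVector x α))) :=
    Finset.sum_pos (fun α _ => Real.exp_pos _) Finset.univ_nonempty
  have h2 := Real.log_le_log hpos h
  rw [Real.log_mul hC.ne' (Real.exp_pos _).ne', Real.log_exp] at h2
  rw [freeEnergy, one_div, inv_mul_le_iff₀ hN]
  refine h2.trans (le_of_eq ?_)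
  field_simp
  ring

variable {μ : Fin n → Measure ℝ} [∀ k, IsProbabilityMeasure (μ k)] {Ω : Type*} [MeasurableSpace Ω]
  {P : Measure Ω} [IsProbabilityMeasure P] {X : (N : ℕ) → Site Θ γ N → Ω → ℝ}

lemma exists_isCompact_ae_eventually (hγ_sum : ∑ k, γ k = 1)
    (hX_indep : ∀ N, iIndepFun (X N) P) (hX_law : ∀ N s, HasLaw (X N s) (μ s.1) P) :
    ∃ K : Set (ProbabilityMeasure (Fin n → ℝ)), IsCompact K ∧ ∀ᵐ ω ∂P, ∀ᶠ N : ℕ in atTop,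
      ∀ α : Config Θ γ (N + 1), empirical (spinVector (fun s => X (N + 1) s ω) α) ∈ K := by
  -- The rate exceeds that of the number of configurations by 1, so the union bound still leaves
  -- `exp (-N)`.
  obtain ⟨K, hK, hKm⟩ := exists_isCompact_empirical (m := Measure.pi μ) (Θ * Real.log 2 + 1)
  refine ⟨K, hK, ?_⟩
  have h := ae_eventually_array_notMem hX_indep hX_law
    (B := fun N => ⋃ α : Config Θ γ (N + 1), {x | spinVector x α ∈ {y | empirical y ∉ K}})
    (C := 1) one_pos (Eventually.of_forall fun N => by
      refine (measure_iUnion_le _).trans ?_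
      rw [tsum_fintype]
      calc _ ≤ ∑ _α : Config Θ γ (N + 1),
            ENNReal.ofReal (Real.exp (-((Θ * Real.log 2 + 1) * (N + 1 : ℕ)))) :=
            Finset.sum_le_sum fun α _ =>
              (siteMeasure_preimage_spinVector_le μ α _).trans (hKm (N + 1))
        _ = ENNReal.ofReal (Fintype.card (Config Θ γ (N + 1)) *
              Real.exp (-((Θ * Real.log 2 + 1) * (N + 1 : ℕ)))) := by
            rw [Finset.sum_const, Finset.card_univ, nsmul_eq_mul,
              ENNReal.ofReal_mul (Nat.cast_nonneg _), ENNReal.ofReal_natCast]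
        _ ≤ _ := by
            refine ENNReal.ofReal_le_ofReal ((mul_le_mul_of_nonneg_right
              (card_config_le_exp hγ_sum (N + 1)) (Real.exp_pos _).le).trans (le_of_eq ?_))
            rw [← Real.exp_add, one_mul]
            ring_nf)
  filter_upwards [h] with ω hω
  filter_upwards [hω] with N hN α
  by_contra hα
  exact hN (Set.mem_iUnion.2 ⟨α, hα⟩)

lemma integral_empirical_eq_of_segment_eq {N : ℕ} [NeZero N] {k : Fin n} {α α' : Config Θ γ N}
    (h : α.segment k = α'.segment k) (x : Site Θ γ N → ℝ)
    {g : ({j : Fin n // j ≤ k} → ℝ) → ℝ} (hg : Measurable g) :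
    ∫ y, g (fun j => y j.1) ∂(empirical (spinVector x α) : Measure (Fin n → ℝ)) =
      ∫ y, g (fun j => y j.1) ∂(empirical (spinVector x α') : Measure (Fin n → ℝ)) := by
  have hm : Measurable fun y : Fin n → ℝ => g fun j => y j.1 := hg.comp (measurable_restrictLE k)
  rw [integral_empirical _ hm, integral_empirical _ hm]
  congr 1
  refine Finset.sum_congr rfl fun i _ => ?_
  congr 1
  funext j
  have hseg : α.segment j.1 = α'.segment j.1 :=
    (segment_eq_iff α α' j.1).2 fun l hl => (segment_eq_iff α α' k).1 h l (hl.trans j.2)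
  simp only [spinVector, hseg]

/-- Measures outside the entropy set have a neighbourhood that eventually contains no empirical
measure. -/
lemma exists_nhds_ae_eventually_notMem (hX_indep : ∀ N, iIndepFun (X N) P)
    (hX_law : ∀ N s, HasLaw (X N s) (μ s.1) P) {ν : ProbabilityMeasure (Fin n → ℝ)}
    (hν : ν ∉ entropySet Θ γ (Measure.pi μ)) :
    ∃ U ∈ 𝓝 ν, ∀ᵐ ω ∂P, ∀ᶠ N : ℕ in atTop,
      ∀ α : Config Θ γ (N + 1), empirical (spinVector (fun s => X (N + 1) s ω) α) ∉ U := by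
  simp only [entropySet, Set.mem_ofPred_eq, not_forall, not_le] at hν
  obtain ⟨k, hk⟩ := hν
  set b := Θ * Real.log 2 * ∑ j ∈ Finset.Iic k, γ j with hb
  obtain ⟨q, hq1, hq2⟩ := exists_between hk
  -- Passing through an intermediate `q` gives a finite rate above `b` even when the marginal
  -- entropy is infinite.
  set a := q.toReal with ha
  have hqa : ENNReal.ofReal a = q := ENNReal.ofReal_toReal (hq2.trans_le le_top).ne
  have hba : b < a := by
    by_contra hcon
    exact absurd (hqa ▸ ENNReal.ofReal_le_ofReal (not_lt.1 hcon)) (not_le.2 hq1)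
  obtain ⟨g, hg⟩ := exists_boundedContinuous_lt (hqa.symm ▸ hq2)
  have hπ := measurable_restrictLE k
  have hπc : Continuous fun (y : Fin n → ℝ) (j : {j : Fin n // j ≤ k}) => y j.1 := by fun_prop
  set g' : BoundedContinuousFunction (Fin n → ℝ) ℝ := g.compContinuous ⟨_, hπc⟩ with hg'
  have hg'm : Measurable g' := g'.continuous.measurable
  have hgm : Measurable g := g.continuous.measurable
  have hg1 : ∫ u, g u ∂(marginal k (ν : Measure (Fin n → ℝ))) =
      ∫ y, g' y ∂(ν : Measure (Fin n → ℝ)) := by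
    rw [marginal, integral_map hπ.aemeasurable hgm.aestronglyMeasurable]
    rfl
  have hg2 : ∫ u, Real.exp (g u) ∂(marginal k (Measure.pi μ)) =
      ∫ y, Real.exp (g' y) ∂(Measure.pi μ) := by
    rw [marginal, integral_map hπ.aemeasurable hgm.exp.aestronglyMeasurable]
    rfl
  rw [hg1, hg2] at hg
  set U : Set (ProbabilityMeasure (Fin n → ℝ)) := {ρ | a < ∫ y, g' y ∂(ρ : Measure (Fin n → ℝ)) -
    Real.log (∫ y, Real.exp (g' y) ∂(Measure.pi μ))} with hU
  have hUo : IsOpen U := isOpen_lt continuous_const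
    ((ProbabilityMeasure.continuous_integral_boundedContinuousFunction g').sub continuous_const)
  refine ⟨U, hUo.mem_nhds hg, ?_⟩
  -- The test function depends on the coordinates up to `k`, so one representative per segment
  -- decides the event. The union bound runs over about `exp (N b)` segments, against a probability
  -- `exp (-a N)` with `a > b`.
  have h := ae_eventually_array_notMem hX_indep hX_law
    (B := fun N => ⋃ s : Segment Θ γ (N + 1) k,
      {x | ∃ α : Config Θ γ (N + 1), α.segment k = s ∧ empirical (spinVector x α) ∈ U})
    (C := 1) (sub_pos.2 hba) (Eventually.of_forall fun N => by
      refine (measure_iUnion_le _).trans ?_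
      rw [tsum_fintype]
      calc _ ≤ ∑ _s : Segment Θ γ (N + 1) k,
            ENNReal.ofReal (Real.exp (-(a * (N + 1 : ℕ)))) := by
            refine Finset.sum_le_sum fun s _ => ?_
            by_cases hs : ∃ α₀ : Config Θ γ (N + 1), α₀.segment k = s
            · obtain ⟨α₀, rfl⟩ := hs
              refine (measure_mono ?_).trans ((siteMeasure_preimage_spinVector_le μ α₀ _).trans
                (chernoff_empirical hg'm (M := ‖g'‖) (fun y => g'.norm_coe_le_norm y) a))
              rintro x ⟨α, hα, hαU⟩
              have := integral_empirical_eq_of_segment_eq hα x hgm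
              change a < ∫ y, g' y ∂(empirical (spinVector x α₀) : Measure (Fin n → ℝ)) - _
              have e : ∫ y, g' y ∂(empirical (spinVector x α₀) : Measure (Fin n → ℝ)) =
                ∫ y, g' y ∂(empirical (spinVector x α) : Measure (Fin n → ℝ)) := this.symm
              rw [e]
              exact hαU
            · have : {x : Site Θ γ (N + 1) → ℝ | ∃ α : Config Θ γ (N + 1), α.segment k = s ∧
                  empirical (spinVector x α) ∈ U} = ∅ :=
                Set.eq_empty_of_forall_notMem fun x ⟨α, hα, _⟩ => hs ⟨α, hα⟩
              rw [this, measure_empty]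
              exact zero_le
        _ = ENNReal.ofReal (Fintype.card (Segment Θ γ (N + 1) k) *
              Real.exp (-(a * (N + 1 : ℕ)))) := by
            rw [Finset.sum_const, Finset.card_univ, nsmul_eq_mul,
              ENNReal.ofReal_mul (Nat.cast_nonneg _), ENNReal.ofReal_natCast]
        _ ≤ _ := by
            have hcard : (Fintype.card (Segment Θ γ (N + 1) k) : ℝ) ≤
                Real.exp ((N + 1 : ℕ) * b) := by
              rw [card_segment]
              exact_mod_cast prod_branching_le_exp (Θ := Θ) (γ := γ) (N + 1) (Finset.Iic k)
            refine ENNReal.ofReal_le_ofReal ((mul_le_mul_of_nonneg_right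
              hcard (Real.exp_pos _).le).trans (le_of_eq ?_))
            rw [← Real.exp_add, one_mul]
            ring_nf)
  filter_upwards [h] with ω hω
  filter_upwards [hω] with N hN α hα
  exact hN (Set.mem_iUnion.2 ⟨α.segment k, α, rfl, hα⟩)

/-- The number of configurations with empirical measure near `ν` is eventually of exponential rate
at most `Θ log 2 - H(ν | μ)`. -/
lemma exists_isOpen_ae_eventually_hitCount_le (hγ_sum : ∑ k, γ k = 1)
    (hX_indep : ∀ N, iIndepFun (X N) P) (hX_law : ∀ N s, HasLaw (X N s) (μ s.1) P)
    (ν : ProbabilityMeasure (Fin n → ℝ)) {ε : ℝ} (hε : 0 < ε) :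
    ∃ U : Set (ProbabilityMeasure (Fin n → ℝ)), IsOpen U ∧ ν ∈ U ∧
      ∀ᵐ ω ∂P, ∀ᶠ N : ℕ in atTop,
        hitCount {y : Fin (N + 1) → Fin n → ℝ | empirical y ∈ U} (fun s => X (N + 1) s ω) ≤
          Real.exp ((N + 1 : ℕ) * (Θ * Real.log 2 -
            (klDiv (ν : Measure (Fin n → ℝ)) (Measure.pi μ)).toReal + 2 * ε)) := by
  set a := (klDiv (ν : Measure (Fin n → ℝ)) (Measure.pi μ)).toReal - ε with ha
  obtain ⟨g, hg⟩ : ∃ g : BoundedContinuousFunction (Fin n → ℝ) ℝ,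
      a < ∫ y, g y ∂(ν : Measure (Fin n → ℝ)) -
        Real.log (∫ y, Real.exp (g y) ∂(Measure.pi μ)) := by
    -- For negative `a` the zero function suffices; this includes infinite entropy, where `toReal`
    -- is 0 and `a = -ε`.
    rcases lt_or_ge a 0 with h0 | h0
    · exact ⟨0, by simpa using h0⟩
    · refine exists_boundedContinuous_lt (lt_of_lt_of_le ?_ ENNReal.ofReal_toReal_le)
      exact (ENNReal.ofReal_lt_ofReal_iff (by linarith)).2 (by linarith)
  have hgm : Measurable g := g.continuous.measurable
  set U : Set (ProbabilityMeasure (Fin n → ℝ)) := {ρ | a < ∫ y, g y ∂(ρ : Measure (Fin n → ℝ)) -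
    Real.log (∫ y, Real.exp (g y) ∂(Measure.pi μ))} with hU
  have hUo : IsOpen U := isOpen_lt continuous_const
    ((ProbabilityMeasure.continuous_integral_boundedContinuousFunction g).sub continuous_const)
  refine ⟨U, hUo, hg, ?_⟩
  have h := ae_eventually_array_notMem hX_indep hX_law
    (B := fun N => {x | Real.exp ((N + 1 : ℕ) * (Θ * Real.log 2 - a + ε)) ≤
      hitCount {y : Fin (N + 1) → Fin n → ℝ | empirical y ∈ U} x})
    (C := 1) hε (Eventually.of_forall fun N => by
      have hAm : MeasurableSet {y : Fin (N + 1) → Fin n → ℝ | empirical y ∈ U} :=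
        (continuous_empirical.isOpen_preimage U hUo).measurableSet
      set A := {y : Fin (N + 1) → Fin n → ℝ | empirical y ∈ U} with hA
      have hmarkov := mul_meas_ge_le_integral_of_nonneg (μ := siteMeasure Θ γ (N + 1) μ)
        (f := hitCount A) (ae_of_all _ fun x => Finset.sum_nonneg fun α _ =>
          Set.indicator_nonneg (fun _ _ => zero_le_one) _)
        (integrable_of_abs_le (measurable_hitCount hAm) abs_hitCount_le _)
        (Real.exp ((N + 1 : ℕ) * (Θ * Real.log 2 - a + ε)))
      rw [integral_hitCount μ hAm] at hmarkov
      have hp : (Measure.pi fun _ : Fin (N + 1) => Measure.pi μ).real A ≤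
          Real.exp (-(a * (N + 1 : ℕ))) :=
        ENNReal.toReal_le_of_le_ofReal (Real.exp_pos _).le
          (chernoff_empirical hgm (M := ‖g‖) (fun y => g.norm_coe_le_norm y) a)
      rw [← ENNReal.ofReal_toReal (measure_ne_top (siteMeasure Θ γ (N + 1) μ) _)]
      refine ENNReal.ofReal_le_ofReal ?_
      have h1 : Real.exp ((N + 1 : ℕ) * (Θ * Real.log 2 - a + ε)) *
          (siteMeasure Θ γ (N + 1) μ).real
            {x | Real.exp ((N + 1 : ℕ) * (Θ * Real.log 2 - a + ε)) ≤ hitCount A x} ≤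
          Real.exp ((N + 1 : ℕ) * (Θ * Real.log 2)) * Real.exp (-(a * (N + 1 : ℕ))) :=
        hmarkov.trans (mul_le_mul (card_config_le_exp hγ_sum (N + 1)) hp measureReal_nonneg
          (Real.exp_pos _).le)
      have h2 : Real.exp ((N + 1 : ℕ) * (Θ * Real.log 2)) * Real.exp (-(a * (N + 1 : ℕ))) =
          Real.exp ((N + 1 : ℕ) * (Θ * Real.log 2 - a + ε)) *
            (1 * Real.exp (-(ε * (N + 1 : ℕ)))) := by
        rw [one_mul, ← Real.exp_add, ← Real.exp_add]
        ring_nf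
      rw [h2] at h1
      exact le_of_mul_le_mul_left h1 (Real.exp_pos _))
  filter_upwards [h] with ω hω
  filter_upwards [hω] with N hN
  have hN' := (not_le.1 hN).le
  refine hN'.trans (le_of_eq ?_)
  rw [ha]
  ring_nf

/-- Inside the entropy set the loss is `2 ε` from the count and `ε` from the variation of `Φ`.
Outside it the partial sum eventually vanishes. -/
lemma exists_nhds_partialSum_le (hγ_sum : ∑ k, γ k = 1)
    (hX_indep : ∀ N, iIndepFun (X N) P) (hX_law : ∀ N s, HasLaw (X N s) (μ s.1) P)
    {Φ : ProbabilityMeasure (Fin n → ℝ) → ℝ} (hΦ : Continuous Φ) {f : ℝ}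
    (hf : ∀ ν ∈ entropySet Θ γ (Measure.pi μ),
      Φ ν - (klDiv (ν : Measure (Fin n → ℝ)) (Measure.pi μ)).toReal + Θ * Real.log 2 ≤ f)
    (ν : ProbabilityMeasure (Fin n → ℝ)) {ε : ℝ} (hε : 0 < ε) :
    ∃ U ∈ 𝓝 ν, ∀ᵐ ω ∂P, ∀ᶠ N : ℕ in atTop,
      partialSum (N := N + 1) Φ U (fun s => X (N + 1) s ω) ≤
        Real.exp ((N + 1 : ℕ) * (f + 3 * ε)) := by
  by_cases hν : ν ∈ entropySet Θ γ (Measure.pi μ)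
  · obtain ⟨U, hUo, hνU, hU⟩ :=
      exists_isOpen_ae_eventually_hitCount_le hγ_sum hX_indep hX_law ν hε
    refine ⟨U ∩ {ρ | Φ ρ < Φ ν + ε}, (hUo.inter (isOpen_lt hΦ continuous_const)).mem_nhds
      ⟨hνU, by simp only [Set.mem_ofPred_eq]; linarith⟩, ?_⟩
    filter_upwards [hU] with ω hω
    filter_upwards [hω] with N hN
    have hNpos : (0 : ℝ) < ((N + 1 : ℕ) : ℝ) := by positivity
    have h1 : partialSum (N := N + 1) Φ (U ∩ {ρ | Φ ρ < Φ ν + ε}) (fun s => X (N + 1) s ω) ≤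
        hitCount {y : Fin (N + 1) → Fin n → ℝ | empirical y ∈ U} (fun s => X (N + 1) s ω) *
          Real.exp ((N + 1 : ℕ) * (Φ ν + ε)) := by
      rw [partialSum, hitCount, Finset.sum_mul]
      refine Finset.sum_le_sum fun α _ => ?_
      set y := spinVector (fun s => X (N + 1) s ω) α
      by_cases hy : empirical y ∈ U ∩ {ρ | Φ ρ < Φ ν + ε}
      · rw [Set.indicator_of_mem hy, Set.indicator_of_mem (show y ∈ {y | empirical y ∈ U} from hy.1),
          one_mul, Real.exp_le_exp]
        exact mul_le_mul_of_nonneg_left (le_of_lt hy.2) hNpos.le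
      · rw [Set.indicator_of_notMem hy]
        exact mul_nonneg (Set.indicator_nonneg (fun _ _ => zero_le_one) _) (Real.exp_pos _).le
    refine h1.trans ((mul_le_mul_of_nonneg_right hN (Real.exp_pos _).le).trans ?_)
    rw [← Real.exp_add, Real.exp_le_exp, ← mul_add]
    exact mul_le_mul_of_nonneg_left (by linarith [hf ν hν]) hNpos.le
  · obtain ⟨U, hU, h⟩ := exists_nhds_ae_eventually_notMem hX_indep hX_law hν
    refine ⟨U, hU, ?_⟩
    filter_upwards [h] with ω hω
    filter_upwards [hω] with N hN
    have : partialSum (N := N + 1) Φ U (fun s => X (N + 1) s ω) = 0 :=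
      Finset.sum_eq_zero fun α _ => Set.indicator_of_notMem (hN α) _
    rw [this]
    exact (Real.exp_pos _).le

lemma ae_eventually_freeEnergy_le (hΘ : 0 < Θ) (hγ : ∀ k, 0 < γ k) (hγ_sum : ∑ k, γ k = 1)
    (hX_indep : ∀ N, iIndepFun (X N) P) (hX_law : ∀ N s, HasLaw (X N s) (μ s.1) P)
    {Φ : ProbabilityMeasure (Fin n → ℝ) → ℝ} (hΦ : Continuous Φ) {f : ℝ}
    (hf : ∀ ν ∈ entropySet Θ γ (Measure.pi μ),
      Φ ν - (klDiv (ν : Measure (Fin n → ℝ)) (Measure.pi μ)).toReal + Θ * Real.log 2 ≤ f)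
    {ε : ℝ} (hε : 0 < ε) :
    ∀ᵐ ω ∂P, ∀ᶠ N : ℕ in atTop,
      freeEnergy (N := N + 1) Φ (fun s => X (N + 1) s ω) < f + ε := by
  obtain ⟨K, hK, hKm⟩ := exists_isCompact_ae_eventually hγ_sum hX_indep hX_law
  have hcover : ∃ C : ℝ, 0 ≤ C ∧ ∀ᵐ ω ∂P, ∀ᶠ N : ℕ in atTop,
      partialSum (N := N + 1) Φ K (fun s => X (N + 1) s ω) ≤
        C * Real.exp ((N + 1 : ℕ) * (f + 3 * (ε / 6))) := by
    -- Compactness in the form of an induction over sets: the constants add up under unions, so the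
    -- local bounds combine. With `ε / 6` locally, half of `ε` remains for `log (C + 1) / N`; the `+
    -- 1` keeps the logarithm's argument positive.
    refine hK.induction_on (p := fun S => ∃ C : ℝ, 0 ≤ C ∧ ∀ᵐ ω ∂P, ∀ᶠ N : ℕ in atTop,
      partialSum (N := N + 1) Φ S (fun s => X (N + 1) s ω) ≤
        C * Real.exp ((N + 1 : ℕ) * (f + 3 * (ε / 6)))) ?_ ?_ ?_ ?_
    · exact ⟨0, le_rfl, ae_of_all _ fun ω => Eventually.of_forall fun N => by simp [partialSum]⟩
    · rintro S T hST ⟨C, hC, h⟩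
      refine ⟨C, hC, ?_⟩
      filter_upwards [h] with ω hω
      filter_upwards [hω] with N hN
      refine le_trans (Finset.sum_le_sum fun α _ => ?_) hN
      exact Set.indicator_le_indicator_of_subset hST (fun _ => (Real.exp_pos _).le) _
    · rintro S T ⟨C, hC, h⟩ ⟨D, hD, h'⟩
      refine ⟨C + D, add_nonneg hC hD, ?_⟩
      filter_upwards [h, h'] with ω hω hω'
      filter_upwards [hω, hω'] with N hN hN'
      rw [add_mul]
      refine le_trans ?_ (add_le_add hN hN')
      rw [partialSum, partialSum, partialSum, ← Finset.sum_add_distrib]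
      refine Finset.sum_le_sum fun α _ => ?_
      set ρ := empirical (spinVector (fun s => X (N + 1) s ω) α)
      have hpos := (Real.exp_pos (((N + 1 : ℕ) : ℝ) * Φ ρ)).le
      by_cases h1 : ρ ∈ S <;> by_cases h2 : ρ ∈ T <;> simp [Set.indicator, h1, h2]
      simpa using hpos
    · intro ν _
      obtain ⟨U, hU, h⟩ := exists_nhds_partialSum_le hγ_sum hX_indep hX_law hΦ hf ν
        (show 0 < ε / 6 by positivity)
      exact ⟨U, mem_nhdsWithin_of_mem_nhds hU, 1, zero_le_one, by simpa only [one_mul] using h⟩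
  obtain ⟨C, hC, hsum⟩ := hcover
  have hsmall : ∀ᶠ N : ℕ in atTop, Real.log (C + 1) / ((N + 1 : ℕ) : ℝ) < ε / 2 :=
    ((tendsto_add_atTop_iff_nat 1).2
      (tendsto_const_div_atTop_nhds_zero_nat (Real.log (C + 1)))).eventually_lt_const (by positivity)
  filter_upwards [hKm, hsum] with ω h1 h2
  filter_upwards [h1, h2, hsmall] with N g1 g2 g3
  have heq : ∑ α : Config Θ γ (N + 1), Real.exp (((N + 1 : ℕ) : ℝ) *
      Φ (empirical (spinVector (fun s => X (N + 1) s ω) α))) =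
      partialSum (N := N + 1) Φ K (fun s => X (N + 1) s ω) :=
    Finset.sum_congr rfl fun α _ => by rw [Set.indicator_of_mem (g1 α)]
  have h3 := freeEnergy_le hΘ hγ (Φ := Φ) (C := C + 1) (by linarith)
    ((heq.trans_le g2).trans (mul_le_mul_of_nonneg_right (by linarith) (Real.exp_pos _).le))
  linarith

/-- A crude bound from `Φ` being bounded on the compact set of exponential tightness. Since `Φ`
itself may be unbounded, this is what makes the supremum finite. -/
lemma exists_ae_eventually_freeEnergy_le (hΘ : 0 < Θ) (hγ : ∀ k, 0 < γ k)
    (hγ_sum : ∑ k, γ k = 1) (hX_indep : ∀ N, iIndepFun (X N) P)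
    (hX_law : ∀ N s, HasLaw (X N s) (μ s.1) P)
    {Φ : ProbabilityMeasure (Fin n → ℝ) → ℝ} (hΦ : Continuous Φ) :
    ∃ b : ℝ, ∀ᵐ ω ∂P, ∀ᶠ N : ℕ in atTop,
      freeEnergy (N := N + 1) Φ (fun s => X (N + 1) s ω) ≤ b := by
  obtain ⟨K, hK, hKm⟩ := exists_isCompact_ae_eventually hγ_sum hX_indep hX_law
  obtain ⟨B, hB⟩ := hK.bddAbove_image hΦ.continuousOn
  refine ⟨Θ * Real.log 2 + B, ?_⟩
  filter_upwards [hKm] with ω hω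
  filter_upwards [hω] with N hN
  have hNpos : (0 : ℝ) < ((N + 1 : ℕ) : ℝ) := by positivity
  have h := freeEnergy_le hΘ hγ (N := N + 1) (Φ := Φ) (x := fun s => X (N + 1) s ω) (C := 1)
    (b := Θ * Real.log 2 + B) one_pos (by
      calc _ ≤ ∑ _α : Config Θ γ (N + 1), Real.exp ((N + 1 : ℕ) * B) :=
            Finset.sum_le_sum fun α _ => Real.exp_le_exp.2
              (mul_le_mul_of_nonneg_left (hB (Set.mem_image_of_mem Φ (hN α))) hNpos.le)
        _ = (Fintype.card (Config Θ γ (N + 1)) : ℝ) * Real.exp ((N + 1 : ℕ) * B) := by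
            rw [Finset.sum_const, Finset.card_univ, nsmul_eq_mul]
        _ ≤ Real.exp ((N + 1 : ℕ) * (Θ * Real.log 2)) * Real.exp ((N + 1 : ℕ) * B) :=
            mul_le_mul_of_nonneg_right (card_config_le_exp hγ_sum (N + 1)) (Real.exp_pos _).le
        _ = _ := by rw [← Real.exp_add, one_mul, mul_add])
  simpa using h

end UpperBound

end

end GREM

/-- **Boltzmann-Gibbs principle.** The relative entropy is finite on the set over which the
supremum is taken, so `toReal` loses nothing there. -/
theorem theorem1 {n : ℕ} (Θ : ℝ) (hΘ : 0 < Θ) (γ : Fin n → ℝ) (hγ : ∀ k, 0 < γ k)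
    (hγ_sum : ∑ k, γ k = 1)
    (μ : Fin n → Measure ℝ) [∀ k, IsProbabilityMeasure (μ k)]
    {Ω : Type*} [MeasurableSpace Ω] (P : Measure Ω) [IsProbabilityMeasure P]
    (X : (N : ℕ) → GREM.Site Θ γ N → Ω → ℝ)
    (hX_indep : ∀ N, iIndepFun (X N) P)
    (hX_law : ∀ N s, HasLaw (X N s) (μ s.1) P)
    (Φ : ProbabilityMeasure (Fin n → ℝ) → ℝ) (hΦ : Continuous Φ) :
    ∃ f : ℝ,
      IsLUB ((fun ν : ProbabilityMeasure (Fin n → ℝ) =>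
          Φ ν - (InformationTheory.klDiv (ν : Measure (Fin n → ℝ)) (Measure.pi μ)).toReal
            + Θ * Real.log 2) '' GREM.entropySet Θ γ (Measure.pi μ)) f ∧
      ∀ᵐ ω ∂P, Tendsto (fun N : ℕ => GREM.freeEnergy (N := N + 1) Φ (fun s => X (N + 1) s ω))
        atTop (𝓝 f) := by
  set V : ProbabilityMeasure (Fin n → ℝ) → ℝ := fun ν =>
    Φ ν - (InformationTheory.klDiv (ν : Measure (Fin n → ℝ)) (Measure.pi μ)).toReal
      + Θ * Real.log 2 with hV
  have hlower : ∀ ν ∈ GREM.entropySet Θ γ (Measure.pi μ), ∀ ε > 0, ∀ᵐ ω ∂P, ∀ᶠ N : ℕ in atTop,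
      V ν - ε ≤ GREM.freeEnergy (N := N + 1) Φ (fun s => X (N + 1) s ω) := fun ν hν ε hε =>
    GREM.ae_eventually_le_freeEnergy hΘ hγ hγ_sum hX_indep hX_law hΦ hν hε
  have hne : (V '' GREM.entropySet Θ γ (Measure.pi μ)).Nonempty := by
    refine ⟨_, ⟨Measure.pi μ, inferInstance⟩, fun k => ?_, rfl⟩
    rw [ProbabilityMeasure.coe_mk, InformationTheory.klDiv_self]
    exact zero_le
  have hbdd : BddAbove (V '' GREM.entropySet Θ γ (Measure.pi μ)) := by
    obtain ⟨b, hb⟩ :=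
      GREM.exists_ae_eventually_freeEnergy_le hΘ hγ hγ_sum hX_indep hX_law hΦ
    refine ⟨b + 1, ?_⟩
    rintro _ ⟨ν, hν, rfl⟩
    -- A deterministic inequality is read off at a single sample point and volume where the almost
    -- sure upper and lower bounds both hold.
    obtain ⟨ω, h1, h2⟩ := (hb.and (hlower ν hν 1 one_pos)).exists
    obtain ⟨N, g1, g2⟩ := (h1.and h2).exists
    linarith
  have hlub := isLUB_csSup hne hbdd
  set f := sSup (V '' GREM.entropySet Θ γ (Measure.pi μ)) with hf
  refine ⟨f, hlub, ?_⟩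
  -- The exceptional null sets depend on the tolerance, so only the countably many values `1 / (j +
  -- 1)` are used.
  have hup : ∀ j : ℕ, ∀ᵐ ω ∂P, ∀ᶠ N : ℕ in atTop,
      GREM.freeEnergy (N := N + 1) Φ (fun s => X (N + 1) s ω) < f + 1 / ((j : ℝ) + 1) := fun j =>
    GREM.ae_eventually_freeEnergy_le hΘ hγ hγ_sum hX_indep hX_law hΦ
      (fun ν hν => hlub.1 (Set.mem_image_of_mem V hν)) (by positivity)
  have hlow : ∀ j : ℕ, ∀ᵐ ω ∂P, ∀ᶠ N : ℕ in atTop,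
      f - 1 / ((j : ℝ) + 1) < GREM.freeEnergy (N := N + 1) Φ (fun s => X (N + 1) s ω) := by
    intro j
    have hj : (0 : ℝ) < 1 / ((j : ℝ) + 1) := by positivity
    obtain ⟨_, ⟨ν, hν, rfl⟩, hlt⟩ :=
      exists_lt_of_lt_csSup hne (show f - 1 / ((j : ℝ) + 1) < f by linarith)
    filter_upwards [hlower ν hν ((V ν - (f - 1 / ((j : ℝ) + 1))) / 2) (by linarith)] with ω hω
    filter_upwards [hω] with N hN
    linarith
  filter_upwards [ae_all_iff.2 hup, ae_all_iff.2 hlow] with ω h1 h2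
  refine tendsto_order.2 ⟨fun a ha => ?_, fun a ha => ?_⟩
  · obtain ⟨j, hj⟩ := exists_nat_one_div_lt (sub_pos.2 ha)
    filter_upwards [h2 j] with N hN
    linarith
  · obtain ⟨j, hj⟩ := exists_nat_one_div_lt (sub_pos.2 ha)
    filter_upwards [h1 j] with N hN
    linarith
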